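/- For a finite $p$-group $G$ of order $p^n$ ($p$ a prime) let $G'$ be its commutator subgroup, $Z(G)$ its centre, and $M(G)=H^2(G,\mathbb{C}^\times)$ (trivial action) its Schur multiplier; the corank $t(G)\ge 0$ is the integer defined by $|M(G)|=p^{\frac12 n(n-1)-t(G)}$. Let $\mathbb{Z}_p^{(4)}\rtimes\mathbb{Z}_p$ denote the semidirect product of $\mathbb{Z}_p^{(4)}=\mathbb{Z}_p^{2}\times\mathbb{Z}_p^{2}$ by $\mathbb{Z}_p$ in which $t\in\mathbb{Z}_p$ acts by $(v,w)\mapsto(v,w+tv)$ (so it is generated by $\alpha,\alpha_1,\alpha_2,\beta_1,\beta_2$ of order $p$, with $[\alpha,\alpha_i]=\beta_i$ for $i=1,2$ and all other pairs of generators commuting). Let $p$ be a prime and let $G$ be a non-abelian $p$-group of order $p^n$ with $|G'|=p^3$ and $t(G)=n+1$. Then $p$ is odd, and for every subgroup $K\subseteq Z(G)\cap G'$ of order $p$ we have $G/K\cong \mathbb{Z}_p^{(4)}\rtimes\mathbb{Z}_p$. In particular, $|G|=p^6$. -/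

import Mathlib

universe u

/-- The Schur multiplier `M(G) = H²(G, ℂˣ)`, the second cohomology group of `G` with coefficients
in the multiplicative group `ℂˣ` on which `G` acts trivially. (`ℂˣ` is written additively; `ULift`
only moves `ℤ` and `ℂˣ` into the universe of `G`.) -/
noncomputable abbrev SchurMultiplier (G : Type u) [Group G] : Type u :=
  groupCohomology.H2 (Rep.trivial (ULift.{u} ℤ) G (ULift.{u} (Additive ℂˣ)))

/-- `HasCorank p G t` says that `t` is the corank `t(G)` of the finite `p`-group `G`: with
`|G| = p ^ n` one has `|M(G)| = p ^ (n (n - 1) / 2 - t)`, written without subtraction of `t`. -/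
def HasCorank (p : ℕ) (G : Type u) [Group G] (t : ℕ) : Prop :=
  ∃ n : ℕ, Nat.card G = p ^ n ∧ Nat.card (SchurMultiplier G) * p ^ t = p ^ (n * (n - 1) / 2)

/-- The unipotent action of `ℤ_p` on `ℤ_p⁴ = ℤ_p² × ℤ_p²`: the element `t` acts by the
automorphism `(v, w) ↦ (v, w + t v)`. -/
def zpFourAction (p : ℕ) :
    Multiplicative (ZMod p) →*
      MulAut (Multiplicative ((Fin 2 → ZMod p) × (Fin 2 → ZMod p))) where
  toFun t :=
    AddEquiv.toMultiplicative
      { toFun := fun x => (x.1, x.2 + t.toAdd • x.1)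
        invFun := fun x => (x.1, x.2 - t.toAdd • x.1)
        left_inv := fun x => by ext <;> simp
        right_inv := fun x => by ext <;> simp
        map_add' := fun x y => by ext <;> simp <;> ring }
  map_one' := by ext x <;> simp
  map_mul' s t := by ext x <;> simp <;> ring

/-- The group `ℤ_p⁽⁴⁾ ⋊ ℤ_p` of order `p⁵`. Writing `α` for the generator of the
complement and `α₁, α₂, β₁, β₂` for the standard basis of `ℤ_p⁽⁴⁾`, the only nontrivial
commutators of generators are `[α, αᵢ] = βᵢ` (`i = 1, 2`) and their inverses. -/
abbrev ZpFourSemidirectZp (p : ℕ) : Type :=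
  Multiplicative ((Fin 2 → ZMod p) × (Fin 2 → ZMod p)) ⋊[zpFourAction p] Multiplicative (ZMod p)

/-! A 2-cocycle on `G` is a central extension of `G` by `ℂˣ`. If `k` is central in `G`, lifts of `g`
and `k` commute up to the scalar `f (g, k) / f (k, g)`, so each class in `M(G)` gives a character of
`G`, its pairing with `k`. A class whose pairing is trivial is inflated from `G ⧸ ⟨k⟩`; if moreover
`k ∈ G'`, the characters of `⟨k⟩` transgress injectively into the kernel of inflation. For `k` of
order `p` this yields `|M(G)| · p ≤ |M(G ⧸ ⟨k⟩)| · #pairings` (`card_cocycleClass_mul_le`).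

Put `n = m + 3` and use this inequality along `G → Q = G ⧸ K → H = Q ⧸ ⟨k⟩ → H ⧸ H'`, where `|H'| =
p`. The first two numbers of pairings are at most `|G : G'| = p ^ m`. The third is at most `p ^ 2`,
because the pairings vanish on the centralizer of two noncommuting elements `a`, `b`. Green's bound
controls `M(H ⧸ H')`. Corank `n + 1` is exactly the case of equality (`le_of_chain_le`), so the
pairings of `Q` and of `H` are as numerous as possible: they detect every element outside `Q'`,
respectively outside `C_H(a, b)`.

On the other hand the pairing with `k` must vanish at `x` if `x` commutes with `y` and `z` while `k
∈ ⟨⁅y, z⁆⟩`, if `k` lies in the subgroup generated by a power of `x`, and in a triple commutator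
situation. Detection forbids these configurations. In `H` this makes `p` odd, the exponent `p` and
`C_H(a, b)` central. In `Q` it gives exponent `p`, class two, and generators `α, β, r` with `⁅r, β⁆
= 1` and `⁅α, β⁆, ⁅α, r⁆` independent, which identifies `Q` with the semidirect product. Its order
`p ^ 5` then gives `|G| = p ^ 6`. -/

open scoped commutatorElement

/-! ### Inhomogeneous 2-cocycles and coboundaries -/

/-- The 2-cocycles of `G` with values in `ℂˣ` (trivial action), written multiplicatively. -/
def Cocycle (G : Type*) [Group G] : Subgroup (G → G → ℂˣ) where
  carrier := {f | ∀ g h j, f (g * h) j * f g h = f h j * f g (h * j)}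
  mul_mem' {f f'} hf hf' g h j := by
    have h1 := hf g h j
    have h2 := hf' g h j
    simp only [Pi.mul_apply]
    rw [mul_mul_mul_comm, h1, h2, mul_mul_mul_comm]
  one_mem' g h j := by simp
  inv_mem' {f} hf g h j := by
    have h1 := hf g h j
    simp only [Pi.inv_apply]
    rw [← mul_inv, h1, mul_inv]

theorem cocycle_spec {G : Type*} [Group G] (f : Cocycle G) (g h j : G) :
    f.1 (g * h) j * f.1 g h = f.1 h j * f.1 g (h * j) := f.2 g h j

theorem cocycle_one_left {G : Type*} [Group G] (f : Cocycle G) (g : G) :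
    f.1 1 g = f.1 1 1 := by
  have := cocycle_spec f 1 1 g
  simp only [one_mul] at this
  exact (mul_left_cancel this).symm

theorem cocycle_one_right {G : Type*} [Group G] (f : Cocycle G) (g : G) :
    f.1 g 1 = f.1 1 1 := by
  have := cocycle_spec f g 1 1
  simp only [mul_one] at this
  exact mul_right_cancel this

/-- The coboundary of a function `G → ℂˣ`. -/
def coboundary (G : Type*) [Group G] : (G → ℂˣ) →* Cocycle G where
  toFun φ := ⟨fun g h => φ g * φ h / φ (g * h), fun g h j => by
    simp only [mul_assoc g h j]
    rw [div_mul_div_comm, div_mul_div_comm, div_eq_div_iff_mul_eq_mul]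
    simp only [mul_comm, mul_left_comm]⟩
  map_one' := Subtype.ext <| by funext g h; simp
  map_mul' φ ψ := Subtype.ext <| by
    funext g h
    simp only [Subgroup.coe_mul, Pi.mul_apply]
    rw [div_mul_div_comm, mul_mul_mul_comm]

theorem coboundary_apply {G : Type*} [Group G] (φ : G → ℂˣ) (g h : G) :
    (coboundary G φ).1 g h = φ g * φ h / φ (g * h) := rfl

/-- The Schur multiplier in terms of inhomogeneous cocycles. -/
abbrev CocycleClass (G : Type*) [Group G] := Cocycle G ⧸ (coboundary G).range

/-! ### Comparison with `groupCohomology.H2` -/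

section Comparison

variable (G : Type u) [Group G]

/-- The cocycle in the sense of `groupCohomology`. -/
noncomputable def toGroupCohomologyCocycle (f : Cocycle G) : groupCohomology.cocycles₂
    (Rep.trivial (ULift.{u} ℤ) G (ULift.{u} (Additive ℂˣ))) :=
  ⟨fun x => ULift.up (Additive.ofMul (f.1 x.1 x.2)), by
    rw [groupCohomology.mem_cocycles₂_iff]
    intro g h j
    exact ULift.ext _ _ (congrArg Additive.ofMul (cocycle_spec f g h j))⟩

theorem H2π_toGroupCohomologyCocycle_eq_iff (a b : Cocycle G) :
    groupCohomology.H2π _ (toGroupCohomologyCocycle G a) =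
      groupCohomology.H2π _ (toGroupCohomologyCocycle G b) ↔ a⁻¹ * b ∈ (coboundary G).range := by
  rw [eq_comm, groupCohomology.H2π_eq_iff]
  constructor
  · rintro ⟨x, hx⟩
    refine ⟨fun g => (x g).down.toMul, Subtype.ext ?_⟩
    funext g h
    have h1 := congrArg (fun z => z.down.toMul) (congrFun hx (g, h))
    change (x h).down.toMul / (x (g * h)).down.toMul * (x g).down.toMul
      = b.1 g h / a.1 g h at h1
    change (x g).down.toMul * (x h).down.toMul / (x (g * h)).down.toMul
      = (a.1 g h)⁻¹ * b.1 g h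
    rw [mul_comm, mul_div_right_comm, h1, div_eq_mul_inv, mul_comm]
  · rintro ⟨φ, hφ⟩
    refine ⟨fun g => ULift.up (Additive.ofMul (φ g)), ?_⟩
    funext x
    have h1 := congrFun (congrFun (congrArg Subtype.val hφ) x.1) x.2
    change φ x.1 * φ x.2 / φ (x.1 * x.2) = (a.1 x.1 x.2)⁻¹ * b.1 x.1 x.2 at h1
    refine ULift.ext _ _ (congrArg Additive.ofMul (?_ : φ x.2 / φ (x.1 * x.2) * φ x.1
      = b.1 x.1 x.2 / a.1 x.1 x.2))
    rw [div_eq_mul_inv (b.1 _ _), mul_comm (b.1 _ _), ← h1, mul_comm, mul_div_assoc]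

theorem card_schurMultiplier : Nat.card (SchurMultiplier G) = Nat.card (CocycleClass G) := by
  refine (Nat.card_congr (Equiv.ofBijective
    (Quotient.lift (fun f => groupCohomology.H2π _ (toGroupCohomologyCocycle G f))
      fun a b hab => (H2π_toGroupCohomologyCocycle_eq_iff G a b).2
        (QuotientGroup.leftRel_apply.1 hab)) ⟨?_, ?_⟩)).symm
  · rintro ⟨a⟩ ⟨b⟩ hab
    exact Quotient.sound
      (QuotientGroup.leftRel_apply.2 ((H2π_toGroupCohomologyCocycle_eq_iff G a b).1 hab))
  · intro x
    induction x using groupCohomology.H2_induction_on with | _ y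
    refine ⟨Quotient.mk _ ⟨fun g h => (y (g, h)).down.toMul, fun g h j => ?_⟩, ?_⟩
    · have := (groupCohomology.mem_cocycles₂_iff y.1).1 y.2 g h j
      exact congrArg (fun z => z.down.toMul) this
    · rfl

end Comparison

theorem commutatorElement_mul_left_of_commute {G : Type*} [Group G] {u : G}
    (hu : ∀ w, Commute u w) (y z : G) : ⁅u * y, z⁆ = ⁅y, z⁆ := by
  have h := (hu (y * z * y⁻¹)).eq
  rw [commutatorElement_def, commutatorElement_def, mul_inv_rev, ← mul_assoc, mul_assoc u, mul_assoc u,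
    h, mul_inv_cancel_right]

theorem commutatorElement_mul_right_of_commute {G : Type*} [Group G] {u : G}
    (hu : ∀ w, Commute u w) (y z : G) : ⁅y, u * z⁆ = ⁅y, z⁆ := by
  rw [← commutatorElement_inv, commutatorElement_mul_left_of_commute hu, commutatorElement_inv]

/-! ### The central extension attached to a cocycle -/

section CentralExtension

variable {G : Type*} [Group G]

/-- The underlying type of the central extension of `G` by `ℂˣ` attached to a cocycle. -/
@[ext]
structure CocycleExtension (f : Cocycle G) where
  /-- The coordinate in `ℂˣ`. -/
  scalar : ℂˣ
  /-- The image in `G`. -/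
  base : G

namespace CocycleExtension

variable (f : Cocycle G)

instance : Mul (CocycleExtension f) := ⟨fun x y => ⟨x.scalar * y.scalar * f.1 x.base y.base, x.base * y.base⟩⟩

instance : One (CocycleExtension f) := ⟨⟨(f.1 1 1)⁻¹, 1⟩⟩

instance : Inv (CocycleExtension f) :=
  ⟨fun x => ⟨x.scalar⁻¹ * (f.1 x.base⁻¹ x.base)⁻¹ * (f.1 1 1)⁻¹, x.base⁻¹⟩⟩

theorem mk_mul_mk (a b : ℂˣ) (g h : G) :
    (⟨a, g⟩ * ⟨b, h⟩ : CocycleExtension f) = ⟨a * b * f.1 g h, g * h⟩ := rfl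

theorem one_eq : (1 : CocycleExtension f) = ⟨(f.1 1 1)⁻¹, 1⟩ := rfl

instance : Group (CocycleExtension f) :=
  Group.ofLeftAxioms
    (fun ⟨a, g⟩ ⟨b, h⟩ ⟨c, j⟩ => by
      simp only [mk_mul_mk, mul_assoc g h j]
      congr 1
      calc a * b * f.1 g h * c * f.1 (g * h) j
          = a * b * c * (f.1 (g * h) j * f.1 g h) := by
            simp only [mul_assoc, mul_comm, mul_left_comm]
        _ = _ := by rw [cocycle_spec]; simp only [mul_assoc, mul_comm, mul_left_comm])
    (fun ⟨a, g⟩ => by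
      rw [one_eq, mk_mul_mk, cocycle_one_left f g, one_mul, mul_right_comm, inv_mul_cancel, one_mul])
    (fun ⟨a, g⟩ => by
      change (⟨a⁻¹ * (f.1 g⁻¹ g)⁻¹ * (f.1 1 1)⁻¹ * a * f.1 g⁻¹ g, g⁻¹ * g⟩ : CocycleExtension f) = _
      rw [one_eq, inv_mul_cancel]
      congr 1
      rw [mul_right_comm _ a, mul_right_comm (a⁻¹ * _), mul_right_comm a⁻¹]
      simp)

/-- The projection of the central extension onto `G`. -/
def proj : CocycleExtension f →* G where
  toFun x := x.base
  map_one' := rfl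
  map_mul' _ _ := rfl

/-- The inclusion of `ℂˣ` in the central extension. -/
def incl : ℂˣ →* CocycleExtension f where
  toFun z := ⟨z * (f.1 1 1)⁻¹, 1⟩
  map_one' := by rw [one_mul]; rfl
  map_mul' z w := by
    rw [mk_mul_mk, one_mul]
    congr 1
    rw [← mul_assoc, inv_mul_cancel_right, mul_right_comm]

@[simp] theorem proj_mk (a : ℂˣ) (g : G) : proj f ⟨a, g⟩ = g := rfl

theorem incl_mul_mk (z a : ℂˣ) (g : G) : incl f z * ⟨a, g⟩ = ⟨z * a, g⟩ := by
  change (⟨z * (f.1 1 1)⁻¹, 1⟩ * ⟨a, g⟩ : CocycleExtension f) = _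
  rw [mk_mul_mk, cocycle_one_left f g, one_mul, mul_right_comm z, inv_mul_cancel_right]

theorem mk_mul_incl (z a : ℂˣ) (g : G) : ⟨a, g⟩ * incl f z = ⟨z * a, g⟩ := by
  change (⟨a, g⟩ * ⟨z * (f.1 1 1)⁻¹, 1⟩ : CocycleExtension f) = _
  rw [mk_mul_mk, cocycle_one_right f g, mul_one, ← mul_assoc, inv_mul_cancel_right, mul_comm]

theorem commute_incl (z : ℂˣ) (x : CocycleExtension f) : Commute (incl f z) x := by
  obtain ⟨a, g⟩ := x
  rw [Commute, SemiconjBy, incl_mul_mk, mk_mul_incl]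

theorem incl_injective : Function.Injective (incl f) := fun _ _ h =>
  mul_right_cancel (congrArg scalar h)

theorem exists_incl_mul_of_proj_eq {x y : CocycleExtension f} (h : proj f x = proj f y) :
    ∃ z, x = incl f z * y := by
  obtain ⟨a, g⟩ := x
  obtain ⟨b, g'⟩ := y
  obtain rfl : g = g' := h
  exact ⟨a * b⁻¹, by rw [incl_mul_mk, inv_mul_cancel_right]⟩

theorem exists_incl_of_proj_eq_one {x : CocycleExtension f} (h : proj f x = 1) :
    ∃ z, x = incl f z := by
  obtain ⟨z, hz⟩ := exists_incl_mul_of_proj_eq f (x := x) (y := 1) (by rw [h, map_one])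
  exact ⟨z, by rw [hz, mul_one]⟩

theorem commute_mk_iff {a b : ℂˣ} {g h : G} (hgh : g * h = h * g) :
    Commute (⟨a, g⟩ : CocycleExtension f) ⟨b, h⟩ ↔ f.1 g h = f.1 h g := by
  rw [Commute, SemiconjBy, mk_mul_mk, mk_mul_mk, hgh, CocycleExtension.mk.injEq, mul_comm b a]
  simp

/-- If `π x` commutes with `π y` and `π z`, then `x` commutes with `⁅y, z⁆`. -/
theorem commute_commutatorElement {x y z : CocycleExtension f}
    (hy : Commute (proj f x) (proj f y)) (hz : Commute (proj f x) (proj f z)) :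
    Commute x ⁅y, z⁆ := by
  -- Conjugation by `x` changes `y` and `z` only by scalars, which commutators do not see.
  have key : ∀ y, Commute (proj f x) (proj f y) → ∃ c, x * y * x⁻¹ = incl f c * y := fun y hy =>
    exists_incl_mul_of_proj_eq f (by
      rw [map_mul, map_mul, map_inv, hy.eq, mul_inv_cancel_right])
  obtain ⟨c, hc⟩ := key y hy
  obtain ⟨d, hd⟩ := key z hz
  have : x * ⁅y, z⁆ * x⁻¹ = ⁅y, z⁆ := by
    rw [conjugate_commutatorElement, hc, hd, commutatorElement_mul_left_of_commute (commute_incl f c),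
      commutatorElement_mul_right_of_commute (commute_incl f d)]
  exact (mul_inv_eq_iff_eq_mul.1 this)

end CocycleExtension

end CentralExtension

/-! ### The pairing with a central element, and where it vanishes -/

section Pairing

variable {G : Type*} [Group G]

/-- The homomorphism `g ↦ f (g, k) / f (k, g)` attached to a cocycle `f` and a central element `k`. -/
def cocyclePairing {k : G} (hk : k ∈ Subgroup.center G) : Cocycle G →* (G →* ℂˣ) where
  toFun f := MonoidHom.mk' (fun g => f.1 g k / f.1 k g) fun g h => by
    have hc : ∀ x, k * x = x * k := fun x => (Subgroup.mem_center_iff.1 hk x).symm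
    have h1 := cocycle_spec f g h k
    have h2 := cocycle_spec f k g h
    have h3 := cocycle_spec f g k h
    rw [hc g] at h2
    rw [hc h] at h3
    rw [div_mul_div_comm, div_eq_div_iff_mul_eq_mul]
    refine mul_right_cancel (b := f.1 (g * k) h * f.1 g h) ?_
    calc f.1 (g * h) k * (f.1 k g * f.1 k h) * (f.1 (g * k) h * f.1 g h)
        = (f.1 (g * h) k * f.1 g h) * (f.1 (g * k) h * f.1 k g) * f.1 k h := by
          simp only [mul_assoc, mul_comm, mul_left_comm]
      _ = f.1 h k * f.1 g h * f.1 k (g * h) * (f.1 k h * f.1 g (h * k)) := by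
          rw [h1, h2]; simp only [mul_assoc, mul_comm, mul_left_comm]
      _ = _ := by rw [← h3]; simp only [mul_assoc, mul_comm, mul_left_comm]
  map_one' := by ext; simp
  map_mul' f f' := MonoidHom.ext fun g => by
    simp only [MonoidHom.mk'_apply, MonoidHom.mul_apply, Subgroup.coe_mul, Pi.mul_apply]
    rw [div_mul_div_comm]

variable {k : G} (hk : k ∈ Subgroup.center G)

theorem cocyclePairing_apply (f : Cocycle G) (g : G) :
    cocyclePairing hk f g = f.1 g k / f.1 k g := rfl

theorem coboundary_range_le_ker_cocyclePairing :
    (coboundary G).range ≤ (cocyclePairing hk).ker := by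
  rintro _ ⟨φ, rfl⟩
  refine MonoidHom.ext fun g => ?_
  rw [cocyclePairing_apply, coboundary_apply, coboundary_apply, (Subgroup.mem_center_iff.1 hk g),
    mul_comm (φ g), div_self', MonoidHom.one_apply]

/-- The pairing as a homomorphism on cohomology classes. -/
def classPairing : CocycleClass G →* (G →* ℂˣ) :=
  QuotientGroup.lift _ (cocyclePairing hk) (coboundary_range_le_ker_cocyclePairing hk)

-- The pairing is the scalar by which lifts of `g` and `k` fail to commute. Any lifts may be used,
-- so a vanishing statement can be proved by exhibiting one convenient lift of `k`, for instance a
-- commutator or a power of other lifts.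
open CocycleExtension in
theorem cocyclePairing_eq_one_iff (f : Cocycle G) (x y : CocycleExtension f) (hy : proj f y = k) :
    cocyclePairing hk f (proj f x) = 1 ↔ Commute x y := by
  obtain ⟨a, g⟩ := x
  obtain ⟨b, g'⟩ := y
  obtain rfl : g' = k := hy
  rw [cocyclePairing_apply, commute_mk_iff f (Subgroup.mem_center_iff.1 hk g), proj_mk, div_eq_one]

open CocycleExtension in
theorem cocyclePairing_eq_one_of_commute (f : Cocycle G) (x y : CocycleExtension f)
    (hy : k ∈ Subgroup.zpowers (proj f y)) (h : Commute x y) :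
    cocyclePairing hk f (proj f x) = 1 := by
  obtain ⟨i, hi⟩ := hy
  exact (cocyclePairing_eq_one_iff hk f x (y ^ i) (by rw [map_zpow]; exact hi)).2 (h.zpow_right i)

/-- A power of the commutator of lifts of `y` and `z` is a lift of `k`, and every lift of `x`
commutes with it. -/
theorem cocyclePairing_commutator_eq_one (f : Cocycle G) {x y z : G} (hxy : Commute x y)
    (hxz : Commute x z) (hyz : k ∈ Subgroup.zpowers ⁅y, z⁆) : cocyclePairing hk f x = 1 := by
  let X : CocycleExtension f := ⟨1, x⟩
  let Y : CocycleExtension f := ⟨1, y⟩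
  let Z : CocycleExtension f := ⟨1, z⟩
  have hp : CocycleExtension.proj f ⁅Y, Z⁆ = ⁅y, z⁆ := by rw [map_commutatorElement]; rfl
  exact cocyclePairing_eq_one_of_commute hk f X ⁅Y, Z⁆ (by rwa [hp])
    (CocycleExtension.commute_commutatorElement f hxy hxz)

/-- If `⁅u, v⁆` commutes with `v` and `⁅⁅u, v⁆, u⁆` is central, then `v` pairs trivially with
`⁅⁅u, v⁆, u⁆`. -/
theorem cocyclePairing_triple_commutator_eq_one (f : Cocycle G) {u v : G}
    (hv : Commute ⁅u, v⁆ v) (hu : ⁅⁅u, v⁆, u⁆ ∈ Subgroup.center G)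
    (hk' : k ∈ Subgroup.zpowers ⁅⁅u, v⁆, u⁆) :
    cocyclePairing hk f v = 1 := by
  let U : CocycleExtension f := ⟨1, u⟩
  let V : CocycleExtension f := ⟨1, v⟩
  have hp : CocycleExtension.proj f ⁅⁅U, V⁆, U⁆ = ⁅⁅u, v⁆, u⁆ := by
    rw [map_commutatorElement, map_commutatorElement]; rfl
  refine cocyclePairing_eq_one_of_commute hk f V ⁅⁅U, V⁆, U⁆ (by rwa [hp]) ?_
  obtain ⟨z, hz⟩ := CocycleExtension.exists_incl_mul_of_proj_eq f (x := V * ⁅U, V⁆ * V⁻¹) (y := ⁅U, V⁆)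
    (by rw [map_mul, map_mul, map_inv, map_commutatorElement]; exact mul_inv_eq_of_eq_mul hv.symm)
  -- A character kills the commutator `⁅u, v⁆`, so `⁅u, v⁆` pairs trivially with the central element
  -- `⁅⁅u, v⁆, u⁆`.
  have hc : Commute ⁅U, V⁆ ⁅⁅U, V⁆, U⁆ := by
    refine (cocyclePairing_eq_one_iff hu f _ _ hp).1 ?_
    rw [map_commutatorElement, map_commutatorElement]
    exact commutatorElement_eq_one_iff_mul_comm.2 (mul_comm _ _)
  have h1 : V * U * V⁻¹ = ⁅U, V⁆⁻¹ * U := by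
    rw [commutatorElement_inv, commutatorElement_def]; group
  -- With `C = ⁅U, V⁆`, conjugation by `V` sends `C` to a scalar multiple of `C` and `U` to `C⁻¹ *
  -- U`, hence `⁅C, U⁆` to `⁅C, C⁻¹ * U⁆ = C⁻¹ * ⁅C, U⁆ * C`.
  have h2 : V * ⁅⁅U, V⁆, U⁆ * V⁻¹ = ⁅⁅U, V⁆, U⁆ := by
    rw [conjugate_commutatorElement, hz,
      commutatorElement_mul_left_of_commute (CocycleExtension.commute_incl f z), h1]
    have h3 : ⁅U, V⁆⁻¹ * ⁅⁅U, V⁆, U⁆ * ⁅U, V⁆ = ⁅⁅U, V⁆, U⁆ := by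
      rw [mul_assoc, ← hc.eq, inv_mul_cancel_left]
    rw [← h3]
    generalize ⁅U, V⁆ = C
    simp only [commutatorElement_def]
    group
  exact mul_inv_eq_iff_eq_mul.1 h2

theorem cocyclePairing_pow_eq_one (f : Cocycle G) {x : G} {n : ℕ}
    (hx : k ∈ Subgroup.zpowers (x ^ n)) : cocyclePairing hk f x = 1 := by
  let X : CocycleExtension f := ⟨1, x⟩
  have hp : CocycleExtension.proj f (X ^ n) = x ^ n := by rw [map_pow]; rfl
  exact cocyclePairing_eq_one_of_commute hk f X (X ^ n) (by rwa [hp]) (Commute.self_pow _ _)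

theorem cocyclePairing_self (f : Cocycle G) : cocyclePairing hk f k = 1 := div_self' _

/-- Conjugation by a lift of `g` multiplies a lift `y` of `k` by the pairing value, but fixes `y ^
orderOf k`, which is a scalar. -/
theorem cocyclePairing_pow_orderOf (f : Cocycle G) (g : G) :
    cocyclePairing hk f g ^ orderOf k = 1 := by
  let x : CocycleExtension f := ⟨1, g⟩
  let y : CocycleExtension f := ⟨1, k⟩
  have h1 : x * y * x⁻¹ = CocycleExtension.incl f (cocyclePairing hk f g) * y := by
    have hxy : x * y = ⟨1 * 1 * f.1 g k, g * k⟩ := rfl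
    have hyx : y * x = ⟨1 * 1 * f.1 k g, k * g⟩ := rfl
    rw [mul_inv_eq_iff_eq_mul, mul_assoc, hxy, hyx, CocycleExtension.incl_mul_mk, cocyclePairing_apply, Subgroup.mem_center_iff.1 hk g]
    simp
  obtain ⟨w, hw⟩ := CocycleExtension.exists_incl_of_proj_eq_one f (x := y ^ orderOf k)
    (by rw [map_pow]; exact pow_orderOf_eq_one k)
  have h2 := congrArg (· ^ orderOf k) h1
  simp only [conj_pow, (CocycleExtension.commute_incl f _ y).mul_pow, hw] at h2
  rw [← (CocycleExtension.commute_incl f w x).eq, mul_inv_cancel_right, eq_comm,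
    mul_eq_right, ← map_pow] at h2
  exact CocycleExtension.incl_injective f (h2.trans (map_one _).symm)

end Pairing

/-! ### Inflation from a quotient -/

section Inflation

variable {G : Type*} [Group G] (N : Subgroup G) [N.Normal]

/-- Inflation of cocycles. -/
def cocycleInflation : Cocycle (G ⧸ N) →* Cocycle G where
  toFun f := ⟨fun g h => f.1 g h, fun g h j => cocycle_spec f g h j⟩
  map_one' := rfl
  map_mul' _ _ := rfl

theorem cocycleInflation_coboundary (φ : G ⧸ N → ℂˣ) :
    cocycleInflation N (coboundary _ φ) = coboundary G (fun g => φ g) := rfl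

/-- Inflation of cohomology classes. -/
def classInflation : CocycleClass (G ⧸ N) →* CocycleClass G :=
  QuotientGroup.map _ _ (cocycleInflation N) <| by
    rintro _ ⟨φ, rfl⟩
    exact ⟨_, (cocycleInflation_coboundary N φ).symm⟩

theorem exists_cocycleInflation_eq (f : Cocycle G)
    (hf : ∀ g h, ∀ u ∈ N, ∀ v ∈ N, f.1 (g * u) (h * v) = f.1 g h) :
    ∃ f', cocycleInflation N f' = f := by
  have hq : ∀ g : G, ∃ u ∈ N, ((g : G ⧸ N)).out = g * u := fun g => by
    obtain ⟨u, hu⟩ := QuotientGroup.mk_out_eq_mul N g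
    exact ⟨u, u.2, hu⟩
  have hf' : ∀ g h : G, f.1 (g : G ⧸ N).out (h : G ⧸ N).out = f.1 g h := fun g h => by
    obtain ⟨u, hu, e⟩ := hq g
    obtain ⟨v, hv, e'⟩ := hq h
    rw [e, e', hf _ _ _ hu _ hv]
  refine ⟨⟨fun q r => f.1 q.out r.out, fun q r s => ?_⟩, Subtype.ext ?_⟩
  · induction q using QuotientGroup.induction_on with | H g
    induction r using QuotientGroup.induction_on with | H h
    induction s using QuotientGroup.induction_on with | H j
    rw [← QuotientGroup.mk_mul, ← QuotientGroup.mk_mul]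
    simp only [hf']
    exact cocycle_spec f g h j
  · funext g h
    exact hf' g h

end Inflation

/-! ### Exactness at inflation, and transgression -/

section Exactness

variable {G : Type*} [Group G] [Finite G]

theorem exists_pow_eq_units_complex (z : ℂˣ) {n : ℕ} (hn : 0 < n) : ∃ w : ℂˣ, w ^ n = z := by
  obtain ⟨w, hw⟩ := IsAlgClosed.exists_pow_nat_eq (z : ℂ) hn
  have h0 : w ≠ 0 := by
    rintro rfl
    rw [zero_pow hn.ne'] at hw
    exact z.ne_zero hw.symm
  exact ⟨Units.mk0 w h0, Units.ext (by simpa using hw)⟩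

/-- If the pairing is trivial, every lift of `k` is central. Since scalars have roots, some lift has
the same order as `k`, so `⟨k⟩` lifts to a central subgroup. A section of the extension compatible
with this lift has a factor set depending only on cosets of `⟨k⟩`. -/
theorem exists_inflation_mul_coboundary {k : G} (hk : k ∈ Subgroup.center G) (N : Subgroup G)
    [N.Normal] (hN : N = Subgroup.zpowers k) (f : Cocycle G) (hf : cocyclePairing hk f = 1) :
    ∃ f' φ, cocycleInflation N f' = f * coboundary G φ := by
  subst hN
  let π := CocycleExtension.proj f
  let ι := CocycleExtension.incl f
  have hι := CocycleExtension.commute_incl f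
  -- a central lift of `k` of the same order
  obtain ⟨y, hyk, hyo⟩ : ∃ y : CocycleExtension f, π y = k ∧ y ^ orderOf k = 1 := by
    let y₀ : CocycleExtension f := ⟨1, k⟩
    obtain ⟨z, hz⟩ := CocycleExtension.exists_incl_of_proj_eq_one f (x := y₀ ^ orderOf k)
      (by rw [map_pow]; exact pow_orderOf_eq_one k)
    obtain ⟨w, hw⟩ := exists_pow_eq_units_complex z⁻¹ (orderOf_pos k)
    refine ⟨ι w * y₀, ?_, ?_⟩
    · rw [map_mul]
      exact one_mul k
    · rw [(hι w y₀).mul_pow, hz, ← map_pow, ← map_mul, hw, inv_mul_cancel, map_one]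
  have hyc : ∀ x, Commute y x := fun x =>
    ((cocyclePairing_eq_one_iff hk f x y hyk).1 (by rw [hf]; rfl)).symm
  have hgen : ∀ u : Subgroup.zpowers k, u ∈ Subgroup.zpowers
      (⟨k, Subgroup.mem_zpowers k⟩ : Subgroup.zpowers k) := by
    rintro ⟨u, i, rfl⟩
    exact ⟨i, Subtype.ext rfl⟩
  let τ : Subgroup.zpowers k →* CocycleExtension f := monoidHomOfForallMemZpowers hgen (g' := y)
    (orderOf_dvd_of_pow_eq_one (by rw [Subgroup.orderOf_mk]; exact hyo))
  have hτ : ∀ u : Subgroup.zpowers k, π (τ u) = u ∧ ∀ x, Commute (τ u) x := by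
    intro u
    obtain ⟨i, rfl⟩ := hgen u
    have : τ (⟨k, Subgroup.mem_zpowers k⟩ ^ i) = y ^ i := by
      rw [map_zpow, monoidHomOfForallMemZpowers_apply_gen]
    rw [this]
    exact ⟨by rw [map_zpow, hyk]; rfl, fun x => (hyc x).zpow_left i⟩
  have hs : ∀ g : G, (g : G ⧸ Subgroup.zpowers k).out⁻¹ * g ∈ Subgroup.zpowers k := fun g =>
    QuotientGroup.eq.1 (QuotientGroup.out_eq' _)
  -- The compatible section: arbitrary on coset representatives, extended by `τ` along each coset.
  let σ : G → CocycleExtension f := fun g =>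
    ⟨1, (g : G ⧸ Subgroup.zpowers k).out⟩ * τ ⟨_, hs g⟩
  have hσπ : ∀ g, π (σ g) = g := fun g => by
    rw [map_mul, (hτ _).1]
    exact mul_inv_cancel_left _ _
  have hσu : ∀ g (u : Subgroup.zpowers k), σ (g * u) = σ g * τ u := fun g u => by
    have e : ((g * u : G) : G ⧸ Subgroup.zpowers k) = g := QuotientGroup.mk_mul_of_mem g u.2
    have e' : (⟨_, hs (g * u)⟩ : Subgroup.zpowers k) = ⟨_, hs g⟩ * u :=
      Subtype.ext ((congrArg (fun q => q.out⁻¹ * (g * u)) e).trans (mul_assoc _ _ _).symm)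
    change _ * τ _ = _ * τ _ * τ u
    rw [e', map_mul, e, mul_assoc]
  clear_value σ
  let φ : G → ℂˣ := fun g => (σ g).scalar
  have hσφ : ∀ g, σ g = ⟨φ g, g⟩ := fun g => CocycleExtension.ext rfl (hσπ g)
  have hF : ∀ g h, σ g * σ h = ι ((f * coboundary G φ).1 g h) * σ (g * h) := fun g h => by
    rw [hσφ g, hσφ h, hσφ (g * h), CocycleExtension.mk_mul_mk, CocycleExtension.incl_mul_mk]
    congr 1
    change _ = f.1 g h * (φ g * φ h / φ (g * h)) * φ (g * h)
    rw [mul_assoc (f.1 g h), div_mul_cancel, mul_comm]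
  obtain ⟨f', hf'⟩ := exists_cocycleInflation_eq (Subgroup.zpowers k) (f * coboundary G φ) (by
    intro g h u hu v hv
    apply CocycleExtension.incl_injective f
    refine mul_right_cancel (b := σ (g * u * (h * v))) ?_
    have h1 := hF (g * u) (h * v)
    have hc : u * h = h * u := ((Subgroup.mem_center_iff.1
      ((Subgroup.zpowers_le.2 hk) hu)) h).symm
    have e : g * u * (h * v) = g * h * ((⟨u, hu⟩ * ⟨v, hv⟩ : Subgroup.zpowers k) : G) := by
      change _ = g * h * (u * v)
      rw [mul_assoc g u, ← mul_assoc u h, hc]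
      simp only [mul_assoc]
    refine h1.symm.trans ?_
    have e1 : σ (g * u) = σ g * τ ⟨u, hu⟩ := hσu g ⟨u, hu⟩
    have e2 : σ (h * v) = σ h * τ ⟨v, hv⟩ := hσu h ⟨v, hv⟩
    rw [e, hσu, ← mul_assoc, ← hF, e1, e2, map_mul, mul_assoc (σ g), ← mul_assoc (τ _),
      ((hτ _).2 (σ h)).eq]
    simp only [mul_assoc])
  exact ⟨f', φ, hf'⟩

theorem ker_classPairing_le {k : G} (hk : k ∈ Subgroup.center G) (N : Subgroup G)
    [N.Normal] (hN : N = Subgroup.zpowers k) :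
    (classPairing hk).ker ≤ (classInflation N).range := by
  intro x hx
  induction x using QuotientGroup.induction_on with | H f
  obtain ⟨f', φ, h⟩ := exists_inflation_mul_coboundary hk N hN f hx
  refine ⟨f', ?_⟩
  change ((cocycleInflation N f' : Cocycle G) : CocycleClass G) = f
  rw [h]
  exact QuotientGroup.mk_mul_of_mem _ ⟨φ, rfl⟩

theorem finite_and_card_monoidHom_units (A : Type*) [Group A] [Finite A] :
    Finite (A →* ℂˣ) ∧ Nat.card (A →* ℂˣ) = Nat.card (Abelianization A) := by
  have e := Abelianization.lift (G := A) (A := ℂˣ)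
  have : Finite (Abelianization A →* ℂˣ) :=
    Nat.finite_of_card_ne_zero (by
      rw [CommGroup.card_monoidHom_of_hasEnoughRootsOfUnity]; exact Nat.card_pos.ne')
  exact ⟨Finite.of_equiv _ e.symm,
    (Nat.card_congr e).trans (CommGroup.card_monoidHom_of_hasEnoughRootsOfUnity _ _)⟩

theorem card_monoidHom_units_of_comm (A : Type*) [Group A] [Finite A] (hA : ∀ x y : A, x * y = y * x) :
    Nat.card (A →* ℂˣ) = Nat.card A := by
  let _ : CommGroup A := { mul_comm := hA }
  exact CommGroup.card_monoidHom_of_hasEnoughRootsOfUnity A ℂ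

/-- Homomorphisms from a central subgroup of the commutator subgroup transgress injectively. -/
theorem card_le_card_ker_classInflation (N : Subgroup G) [N.Normal] [Finite (CocycleClass (G ⧸ N))]
    (hN : N ≤ Subgroup.center G) (hN' : N ≤ commutator G) :
    Nat.card N ≤ Nat.card (classInflation N).ker := by
  have hc : ∀ x y : N, x * y = y * x := fun x y =>
    Subtype.ext ((Subgroup.mem_center_iff.1 (hN x.2) y).symm)
  rw [← card_monoidHom_units_of_comm N hc]
  have hs : ∀ g : G, (g : G ⧸ N).out⁻¹ * g ∈ N := fun g =>
    QuotientGroup.eq.1 (QuotientGroup.out_eq' _)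
  -- An extension of `χ` to a function on `G`, multiplicative along cosets of `N`; its coboundary
  -- therefore descends to `G ⧸ N`.
  let v : (N →* ℂˣ) → G → ℂˣ := fun χ g => χ ⟨_, hs g⟩
  have hv : ∀ χ g (u : N), v χ (g * u) = v χ g * χ u := fun χ g u => by
    have e : ((g * u : G) : G ⧸ N) = g := QuotientGroup.mk_mul_of_mem g u.2
    have e' : (⟨_, hs (g * u)⟩ : N) = ⟨_, hs g⟩ * u :=
      Subtype.ext ((congrArg (fun q => q.out⁻¹ * (g * u)) e).trans (mul_assoc _ _ _).symm)
    change χ _ = χ _ * _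
    rw [e', map_mul]
  have hT : ∀ χ, ∃ f', cocycleInflation N f' = coboundary G (v χ) := fun χ => by
    refine exists_cocycleInflation_eq N _ fun g h u hu w hw => ?_
    have hc : u * h = h * u := (Subgroup.mem_center_iff.1 (hN hu) h).symm
    have e : g * u * (h * w) = g * h * ((⟨u, hu⟩ * ⟨w, hw⟩ : N) : G) := by
      change _ = g * h * (u * w)
      rw [mul_assoc g u, ← mul_assoc u h, hc]
      simp only [mul_assoc]
    have e1 : v χ (g * u) = v χ g * χ ⟨u, hu⟩ := hv χ g ⟨u, hu⟩
    have e2 : v χ (h * w) = v χ h * χ ⟨w, hw⟩ := hv χ h ⟨w, hw⟩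
    rw [coboundary_apply, coboundary_apply, e, hv, e1, e2, map_mul, mul_mul_mul_comm,
      mul_div_mul_right_eq_div]
  choose T hT using hT
  have hker : ∀ χ, (T χ : CocycleClass (G ⧸ N)) ∈ (classInflation N).ker := fun χ => by
    change ((cocycleInflation N (T χ) : Cocycle G) : CocycleClass G) = 1
    rw [hT, QuotientGroup.eq_one_iff]
    exact ⟨_, rfl⟩
  refine Nat.card_le_card_of_injective (fun χ => (⟨_, hker χ⟩ : (classInflation N).ker)) ?_
  intro χ χ' h
  obtain ⟨φ, hφ⟩ := QuotientGroup.eq.1 (congrArg Subtype.val h)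
  have h1 : coboundary G (fun g => φ g) = (coboundary G (v χ))⁻¹ * coboundary G (v χ') := by
    rw [← hT, ← hT, ← cocycleInflation_coboundary, hφ, map_mul, map_inv]
  -- If two transgressed classes agree, this correction of the quotient of the two extensions is a
  -- homomorphism `G → ℂˣ`. It kills `N ≤ G'`, while `φ` is constant on `N`, so the two characters
  -- of `N` coincide.
  let w : G → ℂˣ := (fun g : G => φ g)⁻¹ * ((v χ)⁻¹ * v χ')
  have hw : coboundary G w = 1 := by
    rw [map_mul, map_mul, map_inv, map_inv, h1, inv_mul_cancel]
  let W : G →* ℂˣ := MonoidHom.mk' w fun g h =>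
    (div_eq_one.1 (congrFun (congrFun (congrArg Subtype.val hw) g) h)).symm
  ext u
  have h2 : W u = 1 := Abelianization.commutator_subset_ker W (hN' u.2)
  have h3 : W 1 = 1 := map_one W
  have e : ((u : G) : G ⧸ N) = ((1 : G) : G ⧸ N) := by
    rw [QuotientGroup.mk_one]; exact (QuotientGroup.eq_one_iff _).2 u.2
  have hv' : ∀ χ, v χ u = v χ 1 * χ u := fun χ => by rw [← hv, one_mul]
  change (φ ((u : G) : G ⧸ N))⁻¹ * ((v χ u)⁻¹ * v χ' u) = 1 at h2
  change (φ ((1 : G) : G ⧸ N))⁻¹ * ((v χ 1)⁻¹ * v χ' 1) = 1 at h3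
  rw [hv', hv', e, mul_inv, mul_mul_mul_comm, ← mul_assoc, h3, one_mul, inv_mul_eq_one] at h2
  exact congrArg Units.val h2

end Exactness

/-! ### Counting: one central quotient at a time -/

section Counting

variable {G : Type*} [Group G] [Finite G]

theorem card_eq_card_ker_mul_card_range {A B : Type*} [Group A] [Group B] (φ : A →* B) :
    Nat.card A = Nat.card φ.ker * Nat.card φ.range := by
  rw [← Subgroup.index_ker, Subgroup.card_mul_index]

theorem finite_of_finite_ker_of_finite_range {A B : Type*} [Group A] [Group B] (φ : A →* B)
    [Finite φ.ker] [Finite φ.range] : Finite A :=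
  Nat.finite_of_card_ne_zero (by
    rw [card_eq_card_ker_mul_card_range φ]
    exact Nat.mul_ne_zero Nat.card_pos.ne' Nat.card_pos.ne')

theorem finite_range_classPairing {k : G} (hk : k ∈ Subgroup.center G) :
    Finite (classPairing hk).range :=
  have := (finite_and_card_monoidHom_units G).1
  inferInstance

theorem finite_range_classInflation {G : Type*} [Group G] (N : Subgroup G) [N.Normal] [Finite (CocycleClass (G ⧸ N))] :
    ((classInflation N).range : Set (CocycleClass G)).Finite :=
  Set.finite_range _

theorem finite_cocycleClass_of_quotient {k : G} (hk : k ∈ Subgroup.center G) (N : Subgroup G)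
    [N.Normal] (hN : N = Subgroup.zpowers k) [Finite (CocycleClass (G ⧸ N))] :
    Finite (CocycleClass G) := by
  have := finite_range_classPairing hk
  have : Finite (classPairing hk).ker :=
    (finite_range_classInflation N).subset (ker_classPairing_le hk N hN)
  exact finite_of_finite_ker_of_finite_range (classPairing hk)

theorem card_cocycleClass_le {k : G} (hk : k ∈ Subgroup.center G) (N : Subgroup G)
    [N.Normal] (hN : N = Subgroup.zpowers k) [Finite (CocycleClass (G ⧸ N))] :
    Nat.card (CocycleClass G) ≤
      Nat.card (CocycleClass (G ⧸ N)) * Nat.card (classPairing hk).range := by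
  rw [card_eq_card_ker_mul_card_range (classPairing hk)]
  refine Nat.mul_le_mul_right _ ?_
  refine (Nat.card_mono (finite_range_classInflation N) (ker_classPairing_le hk N hN)).trans ?_
  exact Nat.card_le_card_of_surjective _ (classInflation N).rangeRestrict_surjective

/-- The kernel of the pairing lies in the image of inflation, and the kernel of inflation has at
least `|N|` elements by transgression. -/
theorem card_cocycleClass_mul_le {k : G} (hk : k ∈ Subgroup.center G) (N : Subgroup G)
    [N.Normal] (hN : N = Subgroup.zpowers k) (hk' : k ∈ commutator G)
    [Finite (CocycleClass (G ⧸ N))] :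
    Nat.card (CocycleClass G) * Nat.card N ≤
      Nat.card (CocycleClass (G ⧸ N)) * Nat.card (classPairing hk).range := by
  rw [card_eq_card_ker_mul_card_range (classPairing hk),
    card_eq_card_ker_mul_card_range (classInflation N), mul_right_comm,
    mul_comm (Nat.card (classInflation N).ker)]
  refine Nat.mul_le_mul_right _ (Nat.mul_le_mul
    (Nat.card_mono (finite_range_classInflation N) (ker_classPairing_le hk N hN))
    (card_le_card_ker_classInflation N ?_ ?_))
  · rw [hN]; exact Subgroup.zpowers_le.2 hk
  · rw [hN]; exact Subgroup.zpowers_le.2 hk'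

end Counting

/-! ### Sets of characters trivial on a normal subgroup -/

section Characters

/-- Homomorphisms trivial on `N`, as homomorphisms on the quotient. -/
def quotientCharacter {G : Type*} [Group G] (N : Subgroup G) [N.Normal] (S : Subgroup (G →* ℂˣ))
    (hS : ∀ χ ∈ S, ∀ x ∈ N, χ x = 1) : S → (G ⧸ N →* ℂˣ) := fun χ => QuotientGroup.lift N χ.1 (hS _ χ.2)

theorem quotientCharacter_injective {G : Type*} [Group G] (N : Subgroup G) [N.Normal] (S : Subgroup (G →* ℂˣ))
    (hS : ∀ χ ∈ S, ∀ x ∈ N, χ x = 1) :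
    Function.Injective (quotientCharacter N S hS) :=
  fun _ _ h => Subtype.ext (MonoidHom.ext fun x => DFunLike.congr_fun h (x : G ⧸ N))

theorem card_le_card_quotient {G : Type*} [Group G] [Finite G] (N : Subgroup G) [N.Normal] (S : Subgroup (G →* ℂˣ))
    (hS : ∀ χ ∈ S, ∀ x ∈ N, χ x = 1) :
    Nat.card S ≤ Nat.card (G ⧸ N) := by
  obtain ⟨h1, h2⟩ := finite_and_card_monoidHom_units (G ⧸ N)
  refine (Nat.card_le_card_of_injective _ (quotientCharacter_injective N S hS)).trans ?_
  rw [h2]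
  exact Nat.card_le_card_of_surjective _ (QuotientGroup.mk'_surjective _)

/-- By cardinality `S` consists of all characters of the abelian group `G ⧸ N`, and these separate
points. This converts equality in a counting bound into detection of elements. -/
theorem exists_mem_apply_ne_one {G : Type*} [Group G] [Finite G] (N : Subgroup G) [N.Normal] (S : Subgroup (G →* ℂˣ))
    (hS : ∀ χ ∈ S, ∀ x ∈ N, χ x = 1)
    (hN : commutator G ≤ N) (hcard : Nat.card (G ⧸ N) ≤ Nat.card S)
    {x : G} (hx : x ∉ N) : ∃ χ ∈ S, χ x ≠ 1 := by
  let _ : CommGroup (G ⧸ N) :=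
    { mul_comm := fun a b => by
        induction a using QuotientGroup.induction_on with | H a
        induction b using QuotientGroup.induction_on with | H b
        rw [← commutatorElement_eq_one_iff_mul_comm]
        exact (QuotientGroup.eq_one_iff ⁅a, b⁆).2
          (hN (Subgroup.commutator_mem_commutator (Subgroup.mem_top a) (Subgroup.mem_top b))) }
  have := (finite_and_card_monoidHom_units (G ⧸ N)).1
  have hb := (quotientCharacter_injective N S hS).bijective_of_nat_card_le (by
    rw [card_monoidHom_units_of_comm (G ⧸ N) mul_comm]; exact hcard)
  obtain ⟨χ, hχ⟩ := CommGroup.exists_apply_ne_one_of_hasEnoughRootsOfUnity (G ⧸ N) ℂ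
    (a := (x : G ⧸ N)) (fun h => hx ((QuotientGroup.eq_one_iff x).1 h))
  obtain ⟨ψ, rfl⟩ := hb.2 χ
  exact ⟨ψ.1, ψ.2, hχ⟩

end Characters

/-! ### Central elements of order `p` and Green's bound -/

theorem normal_of_le_center {G : Type*} [Group G] {N : Subgroup G} (hN : N ≤ Subgroup.center G) :
    N.Normal :=
  ⟨fun x hx g => by rwa [Subgroup.mem_center_iff.1 (hN hx) g, mul_inv_cancel_right]⟩

theorem exists_mem_inf_center_orderOf_eq {p n : ℕ} (hp : p.Prime) {G : Type*} [Group G] [Finite G]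
    (hG : Nat.card G = p ^ n) (N : Subgroup G) [N.Normal] (hN : N ≠ ⊥) :
    ∃ k ∈ N ⊓ Subgroup.center G, orderOf k = p := by
  have : Fact p.Prime := ⟨hp⟩
  have hpG : IsPGroup p G := IsPGroup.of_card hG
  have hpC : IsPGroup p (ConjAct G) := hpG
  have hdvd : p ∣ Nat.card N := (hpG.to_subgroup N).card_eq_or_dvd.resolve_left fun h =>
    hN (Subgroup.card_eq_one.1 h)
  obtain ⟨b, hb, hb1⟩ := hpC.exists_fixed_point_of_prime_dvd_card_of_fixed_point N hdvd (a := 1)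
    (fun g => smul_one g)
  have hbc : (b : G) ∈ Subgroup.center G := Subgroup.mem_center_iff.2 fun g => by
    have := congrArg Subtype.val (hb (ConjAct.toConjAct g))
    exact mul_inv_eq_iff_eq_mul.1 this
  have hdvd' : p ∣ Nat.card (N ⊓ Subgroup.center G : Subgroup G) :=
    (hpG.to_subgroup _).card_eq_or_dvd.resolve_left fun h => hb1 (by
      have h1 : (b : G) ∈ N ⊓ Subgroup.center G := ⟨b.2, hbc⟩
      rw [Subgroup.card_eq_one.1 h] at h1
      exact (Subtype.ext (Subgroup.mem_bot.1 h1)).symm)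
  obtain ⟨x, hx⟩ := exists_prime_orderOf_dvd_card' p hdvd'
  exact ⟨x, x.2, by rw [Subgroup.orderOf_coe, hx]⟩

/-- Green's bound for the order of the Schur multiplier of a finite `p`-group. -/
theorem card_cocycleClass_le_of_card_eq {p : ℕ} (hp : p.Prime) (n : ℕ) :
    ∀ (G : Type u) [Group G], Nat.card G = p ^ n →
      Finite (CocycleClass G) ∧ Nat.card (CocycleClass G) ≤ p ^ (n * (n - 1) / 2) := by
  induction n with
  | zero =>
    intro G _ hG
    have : Subsingleton G := (Nat.card_eq_one_iff_unique.1 (by simpa using hG)).1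
    have : Subsingleton (CocycleClass G) := by
      refine ⟨fun a b => ?_⟩
      induction a using QuotientGroup.induction_on with | H a
      induction b using QuotientGroup.induction_on with | H b
      -- On the trivial group a cocycle is a constant, and it is the coboundary of that constant.
      refine QuotientGroup.eq.2 ⟨fun _ => (a⁻¹ * b).1 1 1, Subtype.ext ?_⟩
      funext g h
      rw [coboundary_apply, mul_div_cancel_right, Subsingleton.elim g 1, Subsingleton.elim h 1]
    exact ⟨inferInstance, by simp⟩
  | succ n ih =>
    intro G _ hG
    have : Finite G := Nat.finite_of_card_ne_zero (by rw [hG]; exact pow_ne_zero _ hp.ne_zero)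
    obtain ⟨k, ⟨-, hk⟩, hkp⟩ := exists_mem_inf_center_orderOf_eq hp hG ⊤ (fun h => by
      have h1 := Subgroup.card_top (G := G)
      rw [h, Subgroup.card_bot, hG, eq_comm, Nat.pow_eq_one] at h1
      have := hp.one_lt
      omega)
    have := normal_of_le_center (Subgroup.zpowers_le.2 hk)
    have hq : Nat.card (G ⧸ Subgroup.zpowers k) = p ^ n := by
      have := Subgroup.card_eq_card_quotient_mul_card_subgroup (Subgroup.zpowers k)
      rw [hG, Nat.card_zpowers, hkp, pow_succ] at this
      exact (Nat.mul_right_cancel hp.pos this).symm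
    obtain ⟨h1, h2⟩ := ih _ hq
    refine ⟨finite_cocycleClass_of_quotient hk _ rfl, ?_⟩
    refine (card_cocycleClass_le hk _ rfl).trans ?_
    -- Each pairing with `k` kills `k` itself, so it is a character of the quotient by `⟨k⟩`.
    have h3 : Nat.card (classPairing hk).range ≤ p ^ n := by
      rw [← hq]
      refine card_le_card_quotient _ _ ?_
      rintro _ ⟨x, rfl⟩ _ ⟨i, rfl⟩
      induction x using QuotientGroup.induction_on with | H f
      change cocyclePairing hk f (k ^ i) = 1
      rw [map_zpow, cocyclePairing_self, one_zpow]
    refine (Nat.mul_le_mul h2 h3).trans (le_of_eq ?_)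
    rw [← pow_add]
    rw [Nat.triangle_succ]

/-! ### Groups whose commutator subgroup is central of order `p` -/

section Structure

variable {p : ℕ}

theorem mem_zpowers_of_mem_zpowers_of_ne_one {G : Type*} [Group G] (hp : p.Prime) {k u : G}
    (hk : orderOf k = p) (hu : u ∈ Subgroup.zpowers k) (hu1 : u ≠ 1) : k ∈ Subgroup.zpowers u := by
  have : Fact p.Prime := ⟨hp⟩
  obtain ⟨i, hi⟩ := mem_zpowers_of_prime_card (G := Subgroup.zpowers k) (g := ⟨u, hu⟩)
    (g' := ⟨k, Subgroup.mem_zpowers k⟩) ((Nat.card_zpowers k).trans hk)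
    (fun h => hu1 (congrArg Subtype.val h))
  exact ⟨i, congrArg Subtype.val hi⟩

theorem commutatorElement_mem_commutator {G : Type*} [Group G] (a b : G) :
    ⁅a, b⁆ ∈ commutator G :=
  Subgroup.commutator_mem_commutator (Subgroup.mem_top a) (Subgroup.mem_top b)

theorem conj_zpow_eq_of_central {G : Type*} [Group G] {u a : G} (h : ⁅u, a⁆ ∈ Subgroup.center G)
    (i : ℤ) : a * u ^ i * a⁻¹ = ⁅u, a⁆ ^ (-i) * u ^ i := by
  have h1 : a * u * a⁻¹ = ⁅u, a⁆⁻¹ * u := by rw [commutatorElement_inv, commutatorElement_def]; group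
  have h2 : Commute ⁅u, a⁆⁻¹ u :=
    ((Subgroup.mem_center_iff.1 (inv_mem h) u).symm : ⁅u, a⁆⁻¹ * u = u * ⁅u, a⁆⁻¹)
  rw [← conj_zpow, h1, h2.mul_zpow, inv_zpow, zpow_neg]

/-- The basic correction device: a power of `u` cancels the commutator of `y` with `a`. -/
theorem exists_commute_zpow_mul {G : Type*} [Group G] {u a y : G} (h : ⁅u, a⁆ ∈ Subgroup.center G)
    (hy : ⁅y, a⁆ ∈ Subgroup.zpowers ⁅u, a⁆) : ∃ i : ℤ, Commute (u ^ i * y) a := by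
  obtain ⟨j, hj⟩ := hy
  have h1 : a * y * a⁻¹ = ⁅u, a⁆ ^ (-j) * y := by
    have hj' : ⁅u, a⁆ ^ j = ⁅y, a⁆ := hj
    rw [zpow_neg, hj', commutatorElement_inv, commutatorElement_def]; group
  refine ⟨-j, ?_⟩
  have hc : ⁅u, a⁆ ^ (-j) * (u ^ (-j)) = u ^ (-j) * ⁅u, a⁆ ^ (-j) :=
    (Subgroup.mem_center_iff.1 (zpow_mem h _) _).symm
  have h2 : a * (u ^ (-j) * y) * a⁻¹ = u ^ (-j) * y := by
    calc a * (u ^ (-j) * y) * a⁻¹ = (a * u ^ (-j) * a⁻¹) * (a * y * a⁻¹) := by group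
      _ = u ^ (-j) * y := by
        rw [conj_zpow_eq_of_central h, h1, mul_assoc, ← mul_assoc (u ^ (-j)), ← hc, ← mul_assoc,
          ← mul_assoc, ← zpow_add]
        simp
  exact (mul_inv_eq_iff_eq_mul.1 h2).symm

theorem commute_of_commute_zpow_mul {G : Type*} [Group G] {x y a b : G} {i j : ℤ}
    (ha : Commute x a) (hb : Commute x b) (h : Commute x (a ^ i * (b ^ j * y))) : Commute x y := by
  have h1 := (ha.zpow_right (-i)).mul_right h
  rw [zpow_neg, inv_mul_cancel_left] at h1
  have h2 := (hb.zpow_right (-j)).mul_right h1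
  rwa [zpow_neg, inv_mul_cancel_left] at h2

/-- If the commutator subgroup is generated by an element of order `p`, then the centralizer of two
elements has index at most `p ^ 2`. -/
theorem card_quotient_centralizer_le {G : Type*} [Group G] [Finite G]
    {k : G} (hkp : orderOf k = p) (hcomm : commutator G = Subgroup.zpowers k) (a b : G) :
    Nat.card (G ⧸ Subgroup.centralizer {a, b}) ≤ p ^ 2 := by
  have hc : ∀ x y : G, ⁅x, y⁆ ∈ Subgroup.zpowers k := fun x y =>
    hcomm ▸ commutatorElement_mem_commutator x y
  have key : ∀ x y c : G, ⁅x, c⁆ = ⁅y, c⁆ → Commute (x⁻¹ * y) c := fun x y c h => by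
    have h1 : x * c * x⁻¹ = y * c * y⁻¹ := mul_right_cancel h
    change x⁻¹ * y * c = c * (x⁻¹ * y)
    calc x⁻¹ * y * c = x⁻¹ * (y * c * y⁻¹) * y := by group
      _ = c * (x⁻¹ * y) := by rw [← h1]; group
  calc Nat.card (G ⧸ Subgroup.centralizer {a, b})
      ≤ Nat.card (Subgroup.zpowers k × Subgroup.zpowers k) := by
        -- The pair of commutators with `a` and `b` determines the coset of the centralizer.
        refine Nat.card_le_card_of_injective
          (fun q => (⟨⁅q.out, a⁆, hc _ _⟩, ⟨⁅q.out, b⁆, hc _ _⟩)) fun q r h => ?_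
        have h1 := key _ _ _ (congrArg (fun z => (z.1 : G)) h)
        have h2 := key _ _ _ (congrArg (fun z => (z.2 : G)) h)
        rw [← QuotientGroup.out_eq' q, ← QuotientGroup.out_eq' r]
        refine QuotientGroup.eq.2 (Subgroup.mem_centralizer_iff.2 ?_)
        rintro c (rfl | rfl)
        · exact h1.eq.symm
        · exact h2.eq.symm
    _ = p ^ 2 := by rw [Nat.card_prod, Nat.card_zpowers, hkp, sq]

variable {H : Type*} [Group H] (hp : p.Prime) {k : H} (hk : k ∈ Subgroup.center H)
  (hkp : orderOf k = p) (hcomm : commutator H = Subgroup.zpowers k) {a b : H} (hab : ¬ Commute a b)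

theorem normal_of_commutator_le {G : Type*} [Group G] {N : Subgroup G} (hN : commutator G ≤ N) :
    N.Normal :=
  ⟨fun x hx g => by
    have : g * x * g⁻¹ = ⁅g, x⁆ * x := by rw [commutatorElement_def]; group
    rw [this]
    exact N.mul_mem (hN (commutatorElement_mem_commutator _ _)) hx⟩

theorem commutator_le_centralizer {G : Type*} [Group G] (h : commutator G ≤ Subgroup.center G) (s : Set G) :
    commutator G ≤ Subgroup.centralizer s :=
  h.trans (Subgroup.center_le_centralizer s)

include hp hk hkp hcomm hab

/-- If the commutator subgroup is generated by a central element `k` of order `p`, then the pairings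
with `k` vanish on the centralizer of two noncommuting elements. -/
theorem classPairing_apply_eq_one_of_mem_centralizer :
    ∀ χ ∈ (classPairing hk).range, ∀ x ∈ Subgroup.centralizer {a, b}, χ x = 1 := by
  rintro _ ⟨q, rfl⟩ x hx
  induction q using QuotientGroup.induction_on with | H f
  rw [Subgroup.mem_centralizer_iff] at hx
  refine cocyclePairing_commutator_eq_one hk f (y := a) (z := b) (hx a (by simp)).symm
    (hx b (by simp)).symm ?_
  exact mem_zpowers_of_mem_zpowers_of_ne_one hp hkp (hcomm ▸ commutatorElement_mem_commutator a b)
    (fun h => hab (commutatorElement_eq_one_iff_commute.1 h))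

/-- Since `⁅a, b⁆` generates the commutator subgroup, a power of `b` makes `y` commute with `a`, and
then a power of `a` makes it commute with `b`. -/
theorem exists_zpow_mul_mem_centralizer (y : H) :
    ∃ i j : ℤ, a ^ i * (b ^ j * y) ∈ Subgroup.centralizer {a, b} := by
  have hgen : ∀ c x y : H, ¬ Commute x y → ⁅c, y⁆ ∈ Subgroup.zpowers ⁅x, y⁆ := fun c x y h => by
    have h1 := mem_zpowers_of_mem_zpowers_of_ne_one hp hkp
      (hcomm ▸ commutatorElement_mem_commutator x y)
      (fun h' => h (commutatorElement_eq_one_iff_commute.1 h'))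
    exact (Subgroup.zpowers_le.2 h1) (hcomm ▸ commutatorElement_mem_commutator c y)
  have hcen : ∀ x y : H, ⁅x, y⁆ ∈ Subgroup.center H := fun x y =>
    (hcomm ▸ Subgroup.zpowers_le.2 hk : commutator H ≤ _) (commutatorElement_mem_commutator x y)
  obtain ⟨j, hj⟩ := exists_commute_zpow_mul (hcen b a) (hgen y b a (fun h => hab h.symm))
  obtain ⟨i, hi⟩ := exists_commute_zpow_mul (hcen a b) (hgen (b ^ j * y) a b hab)
  refine ⟨i, j, Subgroup.mem_centralizer_iff.2 ?_⟩
  rintro c (rfl | rfl)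
  · exact (((Commute.refl c).zpow_left i).mul_left hj).eq.symm
  · exact hi.eq.symm

variable [Finite H]

theorem card_range_classPairing_le : Nat.card (classPairing hk).range ≤ p ^ 2 := by
  have : (Subgroup.centralizer {a, b}).Normal := normal_of_commutator_le
    (commutator_le_centralizer (hcomm ▸ Subgroup.zpowers_le.2 hk) _)
  exact (card_le_card_quotient _ _
    (classPairing_apply_eq_one_of_mem_centralizer hp hk hkp hcomm hab)).trans
    (card_quotient_centralizer_le hkp hcomm a b)

/-- When there are `p ^ 2` pairings, `p` is odd, the group has exponent dividing `p`, and the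
centralizer of `a` and `b` is central. -/
theorem structure_of_card_range_classPairing (hpow : ∀ x : H, x ^ p ∈ commutator H)
    (hcard : p ^ 2 ≤ Nat.card (classPairing hk).range) :
    p ≠ 2 ∧ (∀ x : H, x ^ p = 1) ∧ Subgroup.centralizer {a, b} ≤ Subgroup.center H := by
  have hle : commutator H ≤ Subgroup.centralizer {a, b} :=
    commutator_le_centralizer (hcomm ▸ Subgroup.zpowers_le.2 hk) _
  have hN : (Subgroup.centralizer {a, b}).Normal := normal_of_commutator_le hle
  have hsep : ∀ x, x ∉ Subgroup.centralizer {a, b} → ∃ f, cocyclePairing hk f x ≠ 1 := by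
    intro x hx
    obtain ⟨_, ⟨q, rfl⟩, h⟩ := exists_mem_apply_ne_one _ _
      (classPairing_apply_eq_one_of_mem_centralizer hp hk hkp hcomm hab) hle
      ((card_quotient_centralizer_le hkp hcomm a b).trans hcard) hx
    induction q using QuotientGroup.induction_on with | H f
    exact ⟨f, h⟩
  have hmem : ∀ x, x ∈ Subgroup.centralizer {a, b} ↔ Commute x a ∧ Commute x b := fun x => by
    rw [Subgroup.mem_centralizer_iff]
    constructor
    · exact fun h => ⟨(h a (by simp)).symm, (h b (by simp)).symm⟩
    · rintro ⟨h1, h2⟩ c (rfl | rfl)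
      · exact h1.eq.symm
      · exact h2.eq.symm
  have hp1 : ∀ x, x ∉ Subgroup.centralizer {a, b} → x ^ p = 1 := by
    intro x hx
    by_contra h
    obtain ⟨f, hf⟩ := hsep x hx
    exact hf (cocyclePairing_pow_eq_one hk f
      (mem_zpowers_of_mem_zpowers_of_ne_one hp hkp (hcomm ▸ hpow x) h))
  have ha : a ∉ Subgroup.centralizer {a, b} := fun h => hab ((hmem a).1 h).2
  have hb : b ∉ Subgroup.centralizer {a, b} := fun h => hab ((hmem b).1 h).1.symm
  refine ⟨?_, ?_, ?_⟩
  -- The elements `a`, `b`, `a * b` all lie outside the centralizer; if all three square to `1`,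
  -- then `a` and `b` commute.
  · rintro rfl
    have hab' : a * b ∉ Subgroup.centralizer {a, b} := fun h => hab (by
      have := ((hmem _).1 h).1.eq
      rw [mul_assoc] at this
      exact (mul_left_cancel this).symm)
    have h1 := hp1 a ha
    have h2 := hp1 b hb
    have h3 := hp1 _ hab'
    rw [sq] at h1 h2 h3
    apply hab
    change a * b = b * a
    calc a * b = a * b * (a * b) * b⁻¹ * a⁻¹ := by group
      _ = b * a := by rw [h3, one_mul, inv_eq_of_mul_eq_one_left h1, inv_eq_of_mul_eq_one_left h2]
  · intro x
    by_cases hx : x ∈ Subgroup.centralizer {a, b}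
    -- Translating by `a` leaves the centralizer, where `p`-th powers are already known to be
    -- trivial.
    · have h1 : x * a ∉ Subgroup.centralizer {a, b} := fun h =>
        ha ((Subgroup.mul_mem_cancel_left _ hx).1 h)
      have h2 := hp1 _ h1
      rwa [((hmem x).1 hx).1.mul_pow, hp1 a ha, mul_one] at h2
    · exact hp1 x hx
  · intro r hr
    -- two elements of the centralizer commute, as otherwise `a` would pair trivially with `k`
    have hC : ∀ s ∈ Subgroup.centralizer {a, b}, Commute r s := by
      intro s hs
      by_contra h
      obtain ⟨f, hf⟩ := hsep a ha
      exact hf (cocyclePairing_commutator_eq_one hk f ((hmem r).1 hr).1.symm ((hmem s).1 hs).1.symm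
        (mem_zpowers_of_mem_zpowers_of_ne_one hp hkp (hcomm ▸ commutatorElement_mem_commutator r s)
          (fun h' => h (commutatorElement_eq_one_iff_commute.1 h'))))
    refine Subgroup.mem_center_iff.2 fun y => ?_
    obtain ⟨i, j, hij⟩ := exists_zpow_mul_mem_centralizer hp hk hkp hcomm hab y
    have hs := hC _ hij
    exact (commute_of_commute_zpow_mul ((hmem r).1 hr).1 ((hmem r).1 hr).2 hs).eq.symm

end Structure

/-! ### Class, exponent and generators of `Q` -/

section Generators

theorem conj_eq_mul_of_commutatorElement {G : Type*} [Group G] (x y : G) :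
    x * y * x⁻¹ = ⁅x, y⁆ * y := by rw [commutatorElement_def]; group

theorem commutatorElement_ne_one_of_not_commute {G : Type*} [Group G] {x y : G}
    (h : ¬ Commute x y) : ⁅x, y⁆ ≠ 1 :=
  fun h' => h (commutatorElement_eq_one_iff_commute.1 h')

theorem commutatorElement_mem_symm {G : Type*} [Group G] {N : Subgroup G} {x y : G}
    (h : ⁅x, y⁆ ∈ N) : ⁅y, x⁆ ∈ N := by
  rw [← commutatorElement_inv]; exact N.inv_mem h

variable {p : ℕ} (hp : p.Prime) {Q : Type*} [Group Q] {k a b : Q} (hk : k ∈ Subgroup.center Q)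
  (hkp : orderOf k = p)
  (hsep : ∀ x, x ∉ commutator Q → ∃ f, cocyclePairing hk f x ≠ 1)
  (hab : ⁅a, b⁆ ∉ Subgroup.zpowers k)
  (hdec : ∀ y, ∃ i j : ℤ, ∀ x, ⁅a ^ i * (b ^ j * y), x⁆ ∈ Subgroup.zpowers k)
  (hH : ∀ x ∈ commutator Q, ∀ y, ⁅x, y⁆ ∈ Subgroup.zpowers k)
  (hgen : ∀ x ∈ commutator Q, ∃ i : ℤ, ⁅a, b⁆ ^ i * x ∈ Subgroup.zpowers k)

-- Otherwise `⁅⁅u, v⁆, u⁆` generates `⟨k⟩` and the triple commutator lemma makes `v` undetectable,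
-- so `v ∈ Q'`; but then `⁅u, v⁆ ∈ ⟨k⟩`.
include hp hkp hsep hH in
theorem commute_of_commute_commutatorElement {u v : Q} (huv : ⁅u, v⁆ ∉ Subgroup.zpowers k)
    (hv : Commute ⁅u, v⁆ v) : Commute ⁅u, v⁆ u := by
  by_contra h
  have h1 := hH _ (commutatorElement_mem_commutator u v) u
  have hv' : v ∉ commutator Q := fun h2 => huv (commutatorElement_mem_symm (hH v h2 u))
  obtain ⟨f, hf⟩ := hsep v hv'
  exact hf (cocyclePairing_triple_commutator_eq_one hk f hv (Subgroup.zpowers_le.2 hk h1)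
    (mem_zpowers_of_mem_zpowers_of_ne_one hp hkp h1 (commutatorElement_ne_one_of_not_commute h)))

-- Let `R` be the set of elements whose commutators all lie in `⟨k⟩`; `hdec` says that `a`, `b` and
-- `R` generate `Q`. Conjugation by an element of `R` changes `a` and `b` by central factors, hence
-- fixes `⁅a, b⁆`, and it remains to treat `a` and `b`.
include hp hkp hsep hab hdec hH in
theorem commutatorElement_mem_center : ⁅a, b⁆ ∈ Subgroup.center Q := by
  have hKc := Subgroup.zpowers_le.2 hk
  have hcb : Commute ⁅a, b⁆ b := by
    by_contra h
    have h1 : ⁅b, ⁅a, b⁆⁆ ∈ Subgroup.zpowers k :=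
      commutatorElement_mem_symm (hH _ (commutatorElement_mem_commutator a b) b)
    have h2 := mem_zpowers_of_mem_zpowers_of_ne_one hp hkp h1
      (commutatorElement_ne_one_of_not_commute fun h' => h h'.symm)
    -- If `⁅a, b⁆` did not commute with `b`, some `v = a * b ^ (-i)` would commute with it. As `⁅b,
    -- v⁆ = ⁅a, b⁆⁻¹`, the previous lemma applied to `b, v` gives a contradiction.
    obtain ⟨i, hi⟩ := exists_commute_zpow_mul (y := a⁻¹) (hKc h1) (Subgroup.zpowers_le.2 h2
      (commutatorElement_mem_symm (hH _ (commutatorElement_mem_commutator a b) a⁻¹)))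
    have h3 : ⁅b, (b ^ i * a⁻¹)⁻¹⁆ = ⁅a, b⁆⁻¹ := by
      rw [commutatorElement_inv]
      simp only [commutatorElement_def]
      group
    have h4 := commute_of_commute_commutatorElement hp hk hkp hsep hH
      (u := b) (v := (b ^ i * a⁻¹)⁻¹) (by rwa [h3, Subgroup.inv_mem_iff])
      (by rw [h3]; exact hi.symm.inv_inv)
    rw [h3] at h4
    exact h (Commute.inv_left_iff.1 h4)
  have hca : Commute ⁅a, b⁆ a := commute_of_commute_commutatorElement hp hk hkp hsep hH hab hcb
  refine Subgroup.mem_center_iff.2 fun y => ?_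
  obtain ⟨i, j, hr⟩ := hdec y
  have h1 : Commute (a ^ i * (b ^ j * y)) ⁅a, b⁆ := by
    have e : ∀ x, a ^ i * (b ^ j * y) * x * (a ^ i * (b ^ j * y))⁻¹
        = ⁅a ^ i * (b ^ j * y), x⁆ * x := fun x => conj_eq_mul_of_commutatorElement _ _
    have ec : ∀ x w, Commute ⁅a ^ i * (b ^ j * y), x⁆ w := fun x w =>
      (Subgroup.mem_center_iff.1 (hKc (hr x)) w).symm
    refine mul_inv_eq_iff_eq_mul.1 ?_
    rw [conjugate_commutatorElement, e, e, commutatorElement_mul_left_of_commute (ec a),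
      commutatorElement_mul_right_of_commute (ec b)]
  exact (commute_of_commute_zpow_mul hca hcb h1.symm).eq.symm

include hp hkp hsep hab hdec hH hgen in
theorem commutator_le_center : commutator Q ≤ Subgroup.center Q := by
  intro x hx
  obtain ⟨i, hi⟩ := hgen x hx
  exact (Subgroup.mul_mem_cancel_left _ (zpow_mem
    (commutatorElement_mem_center hp hk hkp hsep hab hdec hH) i)).1 (Subgroup.zpowers_le.2 hk hi)

include hp hkp hsep hab hdec hH hgen in
theorem pow_prime_eq_one (hpow : ∀ x : Q, x ^ p ∈ Subgroup.zpowers k) (x : Q) : x ^ p = 1 := by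
  have h1 : ∀ x, x ∉ commutator Q → x ^ p = 1 := fun x hx => by
    by_contra h
    obtain ⟨f, hf⟩ := hsep x hx
    exact hf (cocyclePairing_pow_eq_one hk f
      (mem_zpowers_of_mem_zpowers_of_ne_one hp hkp (hpow x) h))
  have hc := commutatorElement_mem_center hp hk hkp hsep hab hdec hH
  have hcc : ∀ i : ℤ, ∀ y, Commute (⁅a, b⁆ ^ i) y := fun i y =>
    (Subgroup.mem_center_iff.1 (zpow_mem hc i) y).symm
  by_cases hx : x ∈ commutator Q
  · have ha : a ∉ commutator Q := fun h => hab (hH a h b)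
    -- Compare `p`-th powers in `b * a * b⁻¹ = ⁅a, b⁆⁻¹ * a`, where `a ^ p = 1` because `a ∉ Q'`.
    have h2 : ⁅a, b⁆ ^ p = 1 := by
      have h3 : b * a * b⁻¹ = ⁅a, b⁆ ^ (-1 : ℤ) * a := by
        rw [conj_eq_mul_of_commutatorElement, zpow_neg_one, commutatorElement_inv]
      have h4 := congrArg (· ^ p) h3
      simp only [conj_pow, (hcc _ _).mul_pow, h1 a ha, mul_one, mul_inv_cancel] at h4
      rw [zpow_neg_one, inv_pow, eq_comm, inv_eq_one] at h4
      exact h4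
    obtain ⟨i, hi⟩ := hgen x hx
    have h5 : (⁅a, b⁆ ^ i * x) ^ p = 1 := by
      obtain ⟨j, hj⟩ := hi
      rw [← hj]
      change (k ^ j) ^ p = 1
      rw [← zpow_natCast, zpow_comm, zpow_natCast, ← hkp, pow_orderOf_eq_one, one_zpow]
    rw [(hcc i x).mul_pow, ← zpow_natCast, zpow_comm, zpow_natCast, h2, one_zpow, one_mul] at h5
    exact h5
  · exact h1 x hx

include hp hkp hsep in
theorem mem_commutator_of_commute_commute {x y z : Q} (hxy : Commute x y) (hxz : Commute x z)
    (hyz : ⁅y, z⁆ ∈ Subgroup.zpowers k) (hne : ¬ Commute y z) : x ∈ commutator Q := by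
  by_contra hx
  obtain ⟨f, hf⟩ := hsep x hx
  exact hf (cocyclePairing_commutator_eq_one hk f hxy hxz (mem_zpowers_of_mem_zpowers_of_ne_one hp hkp hyz
    (commutatorElement_ne_one_of_not_commute hne)))

-- If all of `R` commuted with `a` and `b`, two noncommuting elements of `R` would make `a`
-- undetectable, so `R` would be central. Then `Q'` would be generated by `⁅a, b⁆`, of order `p`,
-- and `k ∈ Q'` would force `⁅a, b⁆ ∈ ⟨k⟩`.
include hp hkp hsep hab hdec hH hgen in
theorem exists_not_commute (hkc : k ∈ commutator Q)
    (hpow : ∀ x : Q, x ^ p ∈ Subgroup.zpowers k) :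
    ∃ r, (∀ x, ⁅r, x⁆ ∈ Subgroup.zpowers k) ∧ ¬ (Commute r a ∧ Commute r b) := by
  by_contra! hcon
  have hQc := commutator_le_center hp hk hkp hsep hab hdec hH hgen
  have hab' : ¬ Commute a b := fun h => hab (by
    rw [commutatorElement_eq_one_iff_commute.2 h]; exact one_mem _)
  have hRR : ∀ r s, (∀ x, ⁅r, x⁆ ∈ Subgroup.zpowers k) → (∀ x, ⁅s, x⁆ ∈ Subgroup.zpowers k) →
      Commute r s := fun r s hr hs => by
    by_contra h
    have ha := mem_commutator_of_commute_commute hp hk hkp hsep (hcon r hr).1.symm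
      (hcon s hs).1.symm (hr s) h
    exact hab' (Subgroup.mem_center_iff.1 (hQc ha) b).symm
  have hRc : ∀ r, (∀ x, ⁅r, x⁆ ∈ Subgroup.zpowers k) → ∀ y, Commute r y := fun r hr y => by
    obtain ⟨i, j, hij⟩ := hdec y
    exact commute_of_commute_zpow_mul (hcon r hr).1 (hcon r hr).2 (hRR r _ hr hij)
  have hcc := hQc (commutatorElement_mem_commutator a b)
  have hN : (Subgroup.zpowers ⁅a, b⁆).Normal := normal_of_le_center (Subgroup.zpowers_le.2 hcc)
  let π := QuotientGroup.mk' (Subgroup.zpowers ⁅a, b⁆)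
  have h1 : Commute (π a) (π b) := by
    rw [← commutatorElement_eq_one_iff_commute, ← map_commutatorElement]
    exact (QuotientGroup.eq_one_iff _).2 (Subgroup.mem_zpowers _)
  have h2 : ∀ x y, Commute (π x) (π a) → Commute (π x) (π b) → Commute (π x) (π y) :=
    fun x y hxa hxb => by
      obtain ⟨i, j, hij⟩ := hdec y
      refine commute_of_commute_zpow_mul (i := i) (j := j) hxa hxb ?_
      have := ((hRc _ hij x).map π).symm
      rwa [map_mul, map_mul, map_zpow, map_zpow] at this
  have h3 : ∀ x y, Commute (π x) (π y) := fun x y =>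
    h2 x y (h2 a x (Commute.refl _) h1).symm (h2 b x h1.symm (Commute.refl _)).symm
  have h4 : commutator Q ≤ Subgroup.zpowers ⁅a, b⁆ := Subgroup.commutator_le.2 fun x _ y _ => by
    rw [← QuotientGroup.eq_one_iff]
    exact (map_commutatorElement π x y).trans (commutatorElement_eq_one_iff_commute.2 (h3 x y))
  have : Fact p.Prime := ⟨hp⟩
  refine hab (mem_zpowers_of_mem_zpowers_of_ne_one hp (orderOf_eq_prime
    (pow_prime_eq_one hp hk hkp hsep hab hdec hH hgen hpow _)
    (commutatorElement_ne_one_of_not_commute hab')) (h4 hkc) fun h => ?_)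
  rw [h, orderOf_one] at hkp
  exact hp.one_lt.ne hkp

include hp hkp hsep hab hdec hH hgen in
/-- Generators of `Q` adapted to `k`. -/
theorem exists_generators (hkc : k ∈ commutator Q)
    (hpow : ∀ x : Q, x ^ p ∈ Subgroup.zpowers k) :
    ∃ α β r : Q, Commute r β ∧ ⁅α, β⁆ ∉ Subgroup.zpowers k ∧ ⁅α, r⁆ ∈ Subgroup.zpowers k ∧
      ⁅α, r⁆ ≠ 1 ∧ Subgroup.closure {α, β, r} = ⊤ := by
  obtain ⟨r, hr, hr'⟩ := exists_not_commute hp hk hkp hsep hab hdec hH hgen hkc hpow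
  have hKc := Subgroup.zpowers_le.2 hk
  -- If `r` commutes with neither `a` nor `b`, replace `b` by some `a ^ i * b` commuting with `r`;
  -- `⁅a, a ^ i * b⁆` is conjugate to `⁅a, b⁆`.
  obtain ⟨α, β, hrβ, hrα, hαβ, haβ⟩ : ∃ α β : Q, Commute r β ∧ ¬ Commute r α ∧
      ⁅α, β⁆ ∉ Subgroup.zpowers k ∧ {a, b} ⊆ (Subgroup.closure {α, β} : Set Q) := by
    by_cases hb : Commute r b
    · exact ⟨a, b, hb, fun h => hr' ⟨h, hb⟩, hab, Subgroup.subset_closure⟩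
    · by_cases ha : Commute r a
      · refine ⟨b, a, ha, hb, fun h => hab (commutatorElement_mem_symm h), ?_⟩
        rw [Set.pair_comm]
        exact Subgroup.subset_closure
      · have h1 := commutatorElement_mem_symm (hr a)
        obtain ⟨i, hi⟩ := exists_commute_zpow_mul (y := b) (hKc h1) (Subgroup.zpowers_le.2
          (mem_zpowers_of_mem_zpowers_of_ne_one hp hkp h1
            (commutatorElement_ne_one_of_not_commute fun h => ha h.symm))
          (commutatorElement_mem_symm (hr b)))
        refine ⟨a, a ^ i * b, hi.symm, ha, fun h => hab ?_, ?_⟩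
        · have e : ⁅a, b⁆ = a ^ (-i) * ⁅a, a ^ i * b⁆ * (a ^ (-i))⁻¹ := by
            simp only [commutatorElement_def]; group
          rw [e]
          exact (normal_of_le_center hKc).conj_mem _ h _
        · have h1 : a ∈ Subgroup.closure {a, a ^ i * b} := Subgroup.subset_closure (by simp)
          have h2 : a ^ i * b ∈ Subgroup.closure {a, a ^ i * b} := Subgroup.subset_closure (by simp)
          rintro x (rfl | rfl)
          · exact h1
          · exact (Subgroup.mul_mem_cancel_left _ (zpow_mem h1 i)).1 h2
  have hαr : ⁅α, r⁆ ∈ Subgroup.zpowers k := commutatorElement_mem_symm (hr α)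
  have hαr1 : ⁅α, r⁆ ≠ 1 := commutatorElement_ne_one_of_not_commute fun h => hrα h.symm
  have hkα := mem_zpowers_of_mem_zpowers_of_ne_one hp hkp hαr hαr1
  refine ⟨α, β, r, hrβ, hαβ, hαr, hαr1, ?_⟩
  set L := Subgroup.closure {α, β, r} with hL
  have hαL : α ∈ L := Subgroup.subset_closure (by simp)
  have hrL : r ∈ L := Subgroup.subset_closure (by simp)
  have habL : {a, b} ⊆ (L : Set Q) := haβ.trans (SetLike.coe_subset_coe.2
    (Subgroup.closure_mono (by rintro x (rfl | rfl) <;> simp)))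
  have haL : a ∈ L := habL (by simp)
  have hbL : b ∈ L := habL (by simp)
  have hcL : ∀ {x y : Q}, x ∈ L → y ∈ L → ⁅x, y⁆ ∈ L := fun hx hy =>
    L.mul_mem (L.mul_mem (L.mul_mem hx hy) (L.inv_mem hx)) (L.inv_mem hy)
  have hkL : Subgroup.zpowers k ≤ L :=
    (Subgroup.zpowers_le.2 hkα).trans (Subgroup.zpowers_le.2 (hcL hαL hrL))
  have hQL : commutator Q ≤ L := fun x hx => by
    obtain ⟨i, hi⟩ := hgen x hx
    exact (Subgroup.mul_mem_cancel_left _ (zpow_mem (hcL haL hbL) i)).1 (hkL hi)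
  -- Powers of `r` and `α` correct `s ∈ R` to commute with both `α` and `r`. As `⁅r, α⁆` generates
  -- `⟨k⟩`, the corrected element is undetectable and so lies in `Q'`.
  have hRL : ∀ s, (∀ x, ⁅s, x⁆ ∈ Subgroup.zpowers k) → s ∈ L := fun s hs => by
    have hrα' : ⁅r, α⁆ ∈ Subgroup.zpowers k := hr α
    obtain ⟨i, hi⟩ := exists_commute_zpow_mul (y := s) (hKc hrα') (Subgroup.zpowers_le.2
      (mem_zpowers_of_mem_zpowers_of_ne_one hp hkp hrα'
        (commutatorElement_ne_one_of_not_commute hrα)) (hs α))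
    have hs' : ⁅r ^ i * s, r⁆ ∈ Subgroup.zpowers k := by
      have e : ⁅r ^ i * s, r⁆ = r ^ i * ⁅s, r⁆ * (r ^ i)⁻¹ := by
        simp only [commutatorElement_def]; group
      rw [e]
      exact (normal_of_le_center hKc).conj_mem _ (hs r) _
    obtain ⟨j, hj⟩ := exists_commute_zpow_mul (y := r ^ i * s) (hKc hαr)
      (Subgroup.zpowers_le.2 hkα hs')
    have h1 := mem_commutator_of_commute_commute hp hk hkp hsep hj
      (((Commute.refl α).zpow_left j).mul_left hi) (hr α) hrα
    exact (Subgroup.mul_mem_cancel_left _ (zpow_mem hrL i)).1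
      ((Subgroup.mul_mem_cancel_left _ (zpow_mem hαL j)).1 (hQL h1))
  refine (Subgroup.eq_top_iff' _).2 fun y => ?_
  obtain ⟨i, j, hij⟩ := hdec y
  exact (Subgroup.mul_mem_cancel_left _ (zpow_mem hbL j)).1
    ((Subgroup.mul_mem_cancel_left _ (zpow_mem haL i)).1 (hRL _ hij))

end Generators

/-! ### Recognition of the semidirect product -/

section Isomorphism

variable {p : ℕ} {Q : Type*} [Group Q]

/-- The homomorphism from the cyclic group of order `p` sending the generator to `x`. -/
def zmodPowHom (x : Q) (hx : x ^ p = 1) : Multiplicative (ZMod p) →* Q :=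
  AddMonoidHom.toMultiplicativeLeft (ZMod.lift p ⟨zmultiplesHom (Additive Q) (Additive.ofMul x), by
    rw [zmultiplesHom_apply, natCast_zsmul, ← ofMul_pow, hx, ofMul_one]⟩)

theorem zmodPowHom_intCast (x : Q) (hx : x ^ p = 1) (i : ℤ) :
    zmodPowHom x hx (Multiplicative.ofAdd (i : ZMod p)) = x ^ i := by
  exact congrArg Additive.toMul (ZMod.lift_coe p _ i)

theorem zmodPowHom_eq (x : Q) (hx : x ^ p = 1) (t : Multiplicative (ZMod p)) :
    ∃ i : ℤ, t = Multiplicative.ofAdd (i : ZMod p) ∧ zmodPowHom x hx t = x ^ i := by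
  obtain ⟨i, hi⟩ := ZMod.intCast_surjective t.toAdd
  have : t = Multiplicative.ofAdd (i : ZMod p) := by rw [hi]; rfl
  exact ⟨i, this, by rw [this, zmodPowHom_intCast]⟩

theorem zmodPowHom_commute {x y : Q} (h : Commute x y) (hx : x ^ p = 1) (hy : y ^ p = 1)
    (s t : Multiplicative (ZMod p)) : Commute (zmodPowHom x hx s) (zmodPowHom y hy t) := by
  obtain ⟨i, -, hi⟩ := zmodPowHom_eq x hx s
  obtain ⟨j, -, hj⟩ := zmodPowHom_eq y hy t
  rw [hi, hj]
  exact h.zpow_zpow i j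

theorem eq_one_of_zmodPowHom_eq_one (hp : p.Prime) {x : Q} (hx : x ^ p = 1) (hx1 : x ≠ 1)
    {t : Multiplicative (ZMod p)} (h : zmodPowHom x hx t = 1) : t = 1 := by
  have : Fact p.Prime := ⟨hp⟩
  obtain ⟨i, rfl, hi⟩ := zmodPowHom_eq x hx t
  rw [hi, ← orderOf_dvd_iff_zpow_eq_one, orderOf_eq_prime hx hx1] at h
  rw [(ZMod.intCast_zmod_eq_zero_iff_dvd i p).2 h]
  rfl

/-- Commutators with central values are bilinear, which gives the exponent `s * t`. -/
theorem zmodPowHom_conj {x y : Q} (hx : x ^ p = 1) (hy : y ^ p = 1)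
    (hc : ⁅x, y⁆ ∈ Subgroup.center Q) (hz : ⁅x, y⁆ ^ p = 1) (s t : ZMod p) :
    zmodPowHom x hx (.ofAdd s) * zmodPowHom y hy (.ofAdd t) * (zmodPowHom x hx (.ofAdd s))⁻¹ =
      zmodPowHom ⁅x, y⁆ hz (.ofAdd (s * t)) * zmodPowHom y hy (.ofAdd t) := by
  obtain ⟨i, rfl⟩ := ZMod.intCast_surjective s
  obtain ⟨j, rfl⟩ := ZMod.intCast_surjective t
  rw [← Int.cast_mul]
  simp only [zmodPowHom_intCast]
  have h1 : x ^ i * y * (x ^ i)⁻¹ = ⁅x, y⁆ ^ i * y := by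
    have h2 := conj_zpow_eq_of_central hc (-i)
    rw [neg_neg] at h2
    have h3 : x ^ i * (y * x ^ (-i) * y⁻¹) = ⁅x, y⁆ ^ i := by
      rw [h2, ← Subgroup.mem_center_iff.1 (zpow_mem hc i) (x ^ (-i)), ← mul_assoc, ← zpow_add, add_neg_cancel,
        zpow_zero, one_mul]
    rw [← h3]
    group
  have h4 : Commute (⁅x, y⁆ ^ i) y := (Subgroup.mem_center_iff.1 (zpow_mem hc i) y).symm
  rw [← conj_zpow, h1, h4.mul_zpow, zpow_mul]

theorem zmodPowHom_commute_of_mem_center {x : Q} (hx : x ^ p = 1) (h : x ∈ Subgroup.center Q)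
    (s : Multiplicative (ZMod p)) (y : Q) : Commute (zmodPowHom x hx s) y := by
  obtain ⟨i, -, hi⟩ := zmodPowHom_eq x hx s
  rw [hi]
  exact (Subgroup.mem_center_iff.1 (zpow_mem h i) y).symm

theorem zmodPowHom_ofAdd_one (x : Q) (hx : x ^ p = 1) : zmodPowHom x hx (.ofAdd 1) = x := by
  rw [← Int.cast_one, zmodPowHom_intCast, zpow_one]

variable {b r : Q} (hpow : ∀ x : Q, x ^ p = 1)
  (hcen : commutator Q ≤ Subgroup.center Q) (hbr : Commute b r)

/-- The homomorphism from `ℤ_p⁴` given by `b, r, ⁅a, b⁆, ⁅a, r⁆`. -/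
def fourHom (a : Q) : Multiplicative ((Fin 2 → ZMod p) × (Fin 2 → ZMod p)) →* Q :=
  MonoidHom.mk' (fun v =>
    zmodPowHom b (hpow b) (.ofAdd (v.toAdd.1 0)) * zmodPowHom r (hpow r) (.ofAdd (v.toAdd.1 1)) *
    (zmodPowHom ⁅a, b⁆ (hpow _) (.ofAdd (v.toAdd.2 0)) *
      zmodPowHom ⁅a, r⁆ (hpow _) (.ofAdd (v.toAdd.2 1)))) fun v w => by
    have hc : ∀ x s y, Commute (zmodPowHom ⁅a, x⁆ (hpow _) s) y := fun x s y =>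
      zmodPowHom_commute_of_mem_center _ (hcen (commutatorElement_mem_commutator a x)) s y
    have hb := zmodPowHom_commute hbr.symm (hpow _) (hpow _)
    simp only [toAdd_mul, Prod.fst_add, Prod.snd_add, Pi.add_apply, ofAdd_add, map_mul]
    rw [((hc b _ _).mul_left (hc r _ _)).mul_mul_mul_comm, (hb _ _).mul_mul_mul_comm,
      (hc r _ _).mul_mul_mul_comm]

theorem fourHom_apply (a : Q) (v : Multiplicative ((Fin 2 → ZMod p) × (Fin 2 → ZMod p))) :
    fourHom hpow hcen hbr a v =
    zmodPowHom b (hpow b) (.ofAdd (v.toAdd.1 0)) * zmodPowHom r (hpow r) (.ofAdd (v.toAdd.1 1)) *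
    (zmodPowHom ⁅a, b⁆ (hpow _) (.ofAdd (v.toAdd.2 0)) *
      zmodPowHom ⁅a, r⁆ (hpow _) (.ofAdd (v.toAdd.2 1))) := rfl

theorem fourHom_conj (a : Q) (t : ZMod p)
    (v : Multiplicative ((Fin 2 → ZMod p) × (Fin 2 → ZMod p))) :
    zmodPowHom a (hpow a) (.ofAdd t) * fourHom hpow hcen hbr a v *
      (zmodPowHom a (hpow a) (.ofAdd t))⁻¹ =
    zmodPowHom ⁅a, b⁆ (hpow _) (.ofAdd (t * v.toAdd.1 0)) *
      zmodPowHom ⁅a, r⁆ (hpow _) (.ofAdd (t * v.toAdd.1 1)) * fourHom hpow hcen hbr a v := by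
  have hc : ∀ x s y, Commute (zmodPowHom ⁅a, x⁆ (hpow _) s) y := fun x s y =>
    zmodPowHom_commute_of_mem_center _ (hcen (commutatorElement_mem_commutator a x)) s y
  have h1 := zmodPowHom_conj (hpow a) (hpow b) (hcen (commutatorElement_mem_commutator a b))
    (hpow _) t (v.toAdd.1 0)
  have h2 := zmodPowHom_conj (hpow a) (hpow r) (hcen (commutatorElement_mem_commutator a r))
    (hpow _) t (v.toAdd.1 1)
  have h3 := ((hc b (.ofAdd (v.toAdd.2 0)) (zmodPowHom a (hpow a) (.ofAdd t))).mul_left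
    (hc r (.ofAdd (v.toAdd.2 1)) _)).symm.eq
  rw [fourHom_apply, ← conj_mul, ← conj_mul, h1, h2, h3, mul_inv_cancel_right,
    (hc r _ _).symm.mul_mul_mul_comm]
  simp only [mul_assoc]

/-- The homomorphism `ℤ_p⁽⁴⁾ ⋊ ℤ_p → Q` given by `a, b, r`. -/
def semidirectHom (a : Q) : ZpFourSemidirectZp p →* Q :=
  SemidirectProduct.lift (fourHom hpow hcen hbr a) (zmodPowHom a (hpow a)) fun t => by
    refine MonoidHom.ext fun v => ?_
    have hc : ∀ x s y, Commute (zmodPowHom ⁅a, x⁆ (hpow _) s) y := fun x s y =>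
      zmodPowHom_commute_of_mem_center _ (hcen (commutatorElement_mem_commutator a x)) s y
    refine Eq.trans ?_ (fourHom_conj hpow hcen hbr a t.toAdd v).symm
    change fourHom hpow hcen hbr a (.ofAdd (v.toAdd.1, v.toAdd.2 + t.toAdd • v.toAdd.1)) = _
    rw [fourHom_apply, fourHom_apply]
    simp only [toAdd_ofAdd, Pi.add_apply, Pi.smul_apply, smul_eq_mul, ofAdd_add, map_mul]
    rw [(hc r _ _).symm.mul_mul_mul_comm, ((hc b _ _).mul_left (hc r _ _)).eq]
    exact ((hc b _ _).mul_left (hc r _ _)).symm.left_comm _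

theorem semidirectHom_injective (hp : p.Prime) {a : Q} (h1 : ⁅a, r⁆ ≠ 1)
    (h2 : ⁅a, b⁆ ∉ Subgroup.zpowers ⁅a, r⁆) :
    Function.Injective (semidirectHom hpow hcen hbr a) := by
  have : Fact p.Prime := ⟨hp⟩
  have hc : ∀ x s y, Commute (zmodPowHom ⁅a, x⁆ (hpow _) s) y := fun x s y =>
    zmodPowHom_commute_of_mem_center _ (hcen (commutatorElement_mem_commutator a x)) s y
  have h3 : ⁅a, b⁆ ≠ 1 := fun h => h2 (h ▸ one_mem _)
  have hind : ∀ s t, zmodPowHom ⁅a, b⁆ (hpow _) s * zmodPowHom ⁅a, r⁆ (hpow _) t = 1 →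
      s = 1 ∧ t = 1 := fun s t h => by
    have hs : s = 1 := by
      refine eq_one_of_zmodPowHom_eq_one hp (hpow _) h3 (by_contra fun hne => h2 ?_)
      obtain ⟨i, -, hi⟩ := zmodPowHom_eq _ (hpow ⁅a, b⁆) s
      obtain ⟨j, -, hj⟩ := zmodPowHom_eq _ (hpow ⁅a, r⁆) t
      refine Subgroup.zpowers_le.2 ?_ (mem_zpowers_of_mem_zpowers_of_ne_one hp
        (orderOf_eq_prime (hpow ⁅a, b⁆) h3) (hi ▸ ⟨i, rfl⟩) hne)
      rw [eq_inv_of_mul_eq_one_left h, hj]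
      exact inv_mem ⟨j, rfl⟩
    rw [hs, map_one, one_mul] at h
    exact ⟨hs, eq_one_of_zmodPowHom_eq_one hp (hpow _) h1 h⟩
  refine (injective_iff_map_eq_one _).2 ?_
  rintro ⟨v, t⟩ h
  change fourHom hpow hcen hbr a v * zmodPowHom a (hpow a) t = 1 at h
  -- For an element `(v, t)` of the kernel, `a ^ t` commutes with `r`, so `⁅a, r⁆ ^ t = 1`.
  have ht : t = 1 := by
    have h4 : Commute (fourHom hpow hcen hbr a v) r := by
      refine ((?_ : Commute _ r).mul_left ?_).mul_left ((hc b _ r).mul_left (hc r _ r))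
      · obtain ⟨i, -, hi⟩ := zmodPowHom_eq b (hpow b) (.ofAdd (v.toAdd.1 0))
        rw [hi]; exact hbr.zpow_left i
      · obtain ⟨i, -, hi⟩ := zmodPowHom_eq r (hpow r) (.ofAdd (v.toAdd.1 1))
        rw [hi]; exact (Commute.refl r).zpow_left i
    have h5 : Commute (zmodPowHom a (hpow a) t) r := by
      rw [eq_inv_of_mul_eq_one_right h]; exact h4.inv_left
    have h6 := zmodPowHom_conj (hpow a) (hpow r) (hcen (commutatorElement_mem_commutator a r))
      (hpow _) t.toAdd 1
    rw [zmodPowHom_ofAdd_one, ofAdd_toAdd, h5.eq, mul_inv_cancel_right, mul_one, ofAdd_toAdd,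
      eq_comm, mul_eq_right] at h6
    exact eq_one_of_zmodPowHom_eq_one hp (hpow _) h1 h6
  rw [ht, map_one, mul_one] at h
  -- Conjugating the trivial image by `a` isolates the first two coordinates of `v` as exponents of
  -- the independent elements `⁅a, b⁆` and `⁅a, r⁆`.
  have h4 := fourHom_conj hpow hcen hbr a 1 v
  rw [h, mul_one, mul_one, mul_inv_cancel, one_mul, one_mul] at h4
  obtain ⟨h5, h6⟩ := hind _ _ h4.symm
  rw [fourHom_apply, h5, h6, map_one, map_one, one_mul, one_mul] at h
  obtain ⟨h7, h8⟩ := hind _ _ h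
  have hv : v = 1 := by
    refine congrArg Multiplicative.ofAdd (Prod.ext (funext fun i => ?_) (funext fun i => ?_) :
      v.toAdd = 0)
    · fin_cases i
      · exact h5
      · exact h6
    · fin_cases i
      · exact h7
      · exact h8
  rw [hv, ht]
  rfl

theorem semidirectHom_surjective {a : Q} (h : Subgroup.closure {a, b, r} = ⊤) :
    Function.Surjective (semidirectHom hpow hcen hbr a) := by
  rw [← MonoidHom.range_eq_top, eq_top_iff, ← h, Subgroup.closure_le]
  have hf : ∀ i j, fourHom hpow hcen hbr a (.ofAdd (![i, j], 0)) =
      zmodPowHom b (hpow b) (.ofAdd i) * zmodPowHom r (hpow r) (.ofAdd j) := fun i j => by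
    rw [fourHom_apply]
    change _ * (zmodPowHom _ _ 1 * zmodPowHom _ _ 1) = _
    rw [map_one, map_one, mul_one, mul_one]
    rfl
  rintro x (rfl | rfl | rfl)
  · exact ⟨SemidirectProduct.inr (.ofAdd 1), by
      rw [semidirectHom, SemidirectProduct.lift_inr, zmodPowHom_ofAdd_one]⟩
  · refine ⟨SemidirectProduct.inl (.ofAdd (![1, 0], 0)), ?_⟩
    rw [semidirectHom, SemidirectProduct.lift_inl, hf, zmodPowHom_ofAdd_one, ofAdd_zero, map_one,
      mul_one]
  · refine ⟨SemidirectProduct.inl (.ofAdd (![0, 1], 0)), ?_⟩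
    rw [semidirectHom, SemidirectProduct.lift_inl, hf, zmodPowHom_ofAdd_one, ofAdd_zero, map_one,
      one_mul]

end Isomorphism

theorem card_zpFourSemidirectZp (p : ℕ) : Nat.card (ZpFourSemidirectZp p) = p ^ 5 := by
  rw [SemidirectProduct.card]
  have h : Nat.card (Fin 2 → ZMod p) = p ^ 2 := by
    rw [Nat.card_fun, Nat.card_fin, Nat.card_zmod]
  have h1 : Nat.card (Multiplicative ((Fin 2 → ZMod p) × (Fin 2 → ZMod p))) = p ^ 2 * p ^ 2 :=
    (Nat.card_congr Multiplicative.toAdd).trans (by rw [Nat.card_prod, h])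
  have h2 : Nat.card (Multiplicative (ZMod p)) = p :=
    (Nat.card_congr Multiplicative.toAdd).trans (Nat.card_zmod p)
  rw [h1, h2]
  ring

/-! ### The chain of inequalities and the conclusion -/

section Assembly

variable {p : ℕ}

theorem index_commutator_quotient {G : Type*} [Group G] (N : Subgroup G) [N.Normal]
    (hN : N ≤ commutator G) : (commutator (G ⧸ N)).index = (commutator G).index := by
  have hs := QuotientGroup.mk'_surjective N
  have h1 : commutator (G ⧸ N) = (commutator G).map (QuotientGroup.mk' N) := by
    rw [commutator_def, commutator_def, Subgroup.map_commutator, Subgroup.map_top_of_surjective _ hs]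
  rw [← Subgroup.index_comap_of_surjective _ hs, h1, Subgroup.comap_map_eq, QuotientGroup.ker_mk',
    sup_eq_left.2 hN]

theorem card_range_classPairing_le_index {G : Type*} [Group G] [Finite G] {k : G}
    (hk : k ∈ Subgroup.center G) :
    Nat.card (classPairing hk).range ≤ (commutator G).index :=
  card_le_card_quotient (commutator G) _ fun χ _ _ hx => Abelianization.commutator_subset_ker χ hx

theorem exists_cocyclePairing_ne_one {G : Type*} [Group G] [Finite G] {k : G}
    (hk : k ∈ Subgroup.center G) (h : (commutator G).index ≤ Nat.card (classPairing hk).range)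
    (x : G) (hx : x ∉ commutator G) : ∃ f, cocyclePairing hk f x ≠ 1 := by
  obtain ⟨_, ⟨q, rfl⟩, h⟩ := exists_mem_apply_ne_one (commutator G) (classPairing hk).range
    (fun χ _ _ hx => Abelianization.commutator_subset_ker χ hx) le_rfl h hx
  induction q using QuotientGroup.induction_on with | H f
  exact ⟨f, h⟩

theorem exists_central_generator (hp : p.Prime) {G : Type*} [Group G] [Finite G] {n : ℕ}
    (hG : Nat.card G = p ^ n) (h : Nat.card (commutator G) ≠ 1) :
    ∃ k, k ∈ commutator G ∧ k ∈ Subgroup.center G ∧ orderOf k = p := by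
  obtain ⟨k, ⟨h1, h2⟩, h3⟩ := exists_mem_inf_center_orderOf_eq hp hG (commutator G)
    (fun h' => h (by rw [h', Subgroup.card_bot]))
  exact ⟨k, h1, h2, h3⟩

/-- Let `k` be a central commutator of order `p` in `Q` such that `Q ⧸ ⟨k⟩` has commutator subgroup
of order `p`. If the pairings with `k`, and those with a generator of the commutator subgroup of
`Q ⧸ ⟨k⟩`, are as many as possible, then `p` is odd and `Q` is `ℤ_p⁽⁴⁾ ⋊ ℤ_p`. -/
theorem nonempty_mulEquiv_of_card_range (hp : p.Prime) {Q : Type*} [Group Q] [Finite Q] {k : Q}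
    (hk : k ∈ Subgroup.center Q) (hkc : k ∈ commutator Q) (hkp : orderOf k = p)
    [(Subgroup.zpowers k).Normal]
    (hrange : (commutator Q).index ≤ Nat.card (classPairing hk).range)
    {z : Q ⧸ Subgroup.zpowers k} (hz : z ∈ Subgroup.center (Q ⧸ Subgroup.zpowers k))
    (hzp : orderOf z = p) (hcomm : commutator (Q ⧸ Subgroup.zpowers k) = Subgroup.zpowers z)
    (hrange' : p ^ 2 ≤ Nat.card (classPairing hz).range) :
    p ≠ 2 ∧ Nonempty (Q ≃* ZpFourSemidirectZp p) := by
  let π := QuotientGroup.mk' (Subgroup.zpowers k)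
  have hπ : Function.Surjective π := QuotientGroup.mk'_surjective _
  have hπ1 : ∀ x, π x = 1 ↔ x ∈ Subgroup.zpowers k := QuotientGroup.eq_one_iff
  have hπc : ∀ x ∈ commutator Q, π x ∈ commutator (Q ⧸ Subgroup.zpowers k) := fun x hx => by
    have : (commutator Q).map π ≤ commutator (Q ⧸ Subgroup.zpowers k) := by
      rw [commutator_def, Subgroup.map_commutator, commutator_def]
      exact Subgroup.commutator_mono le_top le_top
    exact this (Subgroup.mem_map_of_mem π hx)
  have hsep := exists_cocyclePairing_ne_one hk hrange
  -- Pairings with `k` take values in the `p`-th roots of unity, so no `p`-th power is detected.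
  have hpowQ : ∀ x : Q, x ^ p ∈ commutator Q := fun x => by
    by_contra h
    obtain ⟨f, hf⟩ := hsep _ h
    rw [map_pow, ← hkp, cocyclePairing_pow_orderOf] at hf
    exact hf rfl
  have hpowH : ∀ x : Q ⧸ Subgroup.zpowers k, x ^ p ∈ commutator (Q ⧸ Subgroup.zpowers k) := fun x => by
    obtain ⟨y, rfl⟩ := hπ x
    rw [← map_pow]
    exact hπc _ (hpowQ y)
  obtain ⟨a, b, hab⟩ : ∃ a b : Q, ¬ Commute (π a) (π b) := by
    by_contra! h
    have h1 : commutator (Q ⧸ Subgroup.zpowers k) ≤ ⊥ := Subgroup.commutator_le.2 fun x _ y _ => by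
      obtain ⟨x, rfl⟩ := hπ x
      obtain ⟨y, rfl⟩ := hπ y
      exact commutatorElement_eq_one_iff_commute.2 (h x y)
    rw [hcomm, Subgroup.zpowers_le, Subgroup.mem_bot] at h1
    rw [h1, orderOf_one] at hzp
    exact hp.one_lt.ne hzp
  obtain ⟨h2, hpow1, hCZ⟩ :=
    structure_of_card_range_classPairing hp hz hzp hcomm hab hpowH hrange'
  refine ⟨h2, ?_⟩
  have hcommel : ∀ x y, π ⁅x, y⁆ = ⁅π x, π y⁆ := map_commutatorElement π
  have hab' : ⁅a, b⁆ ∉ Subgroup.zpowers k := fun h => hab (by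
    rwa [← hπ1, hcommel, commutatorElement_eq_one_iff_commute] at h)
  have hpow : ∀ x : Q, x ^ p ∈ Subgroup.zpowers k := fun x => by
    rw [← hπ1, map_pow]; exact hpow1 _
  have hcen : ∀ x y, π x ∈ Subgroup.center (Q ⧸ Subgroup.zpowers k) → ⁅x, y⁆ ∈ Subgroup.zpowers k :=
    fun x y h => by
      rw [← hπ1, hcommel, commutatorElement_eq_one_iff_mul_comm]
      exact (Subgroup.mem_center_iff.1 h _).symm
  have hdec : ∀ y, ∃ i j : ℤ, ∀ x, ⁅a ^ i * (b ^ j * y), x⁆ ∈ Subgroup.zpowers k := fun y => by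
    obtain ⟨i, j, hij⟩ := exists_zpow_mul_mem_centralizer hp hz hzp hcomm hab (π y)
    refine ⟨i, j, fun x => hcen _ _ ?_⟩
    rw [map_mul, map_mul, map_zpow, map_zpow]
    exact hCZ hij
  have hH : ∀ x ∈ commutator Q, ∀ y, ⁅x, y⁆ ∈ Subgroup.zpowers k := fun x hx y =>
    hcen x y ((Subgroup.zpowers_le.2 hz) (hcomm ▸ hπc x hx))
  have hgen : ∀ x ∈ commutator Q, ∃ i : ℤ, ⁅a, b⁆ ^ i * x ∈ Subgroup.zpowers k := fun x hx => by
    have h1 := mem_zpowers_of_mem_zpowers_of_ne_one hp hzp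
      (hcomm ▸ commutatorElement_mem_commutator (π a) (π b))
      (commutatorElement_ne_one_of_not_commute hab)
    obtain ⟨i, hi⟩ := Subgroup.zpowers_le.2 h1 (hcomm ▸ hπc x hx)
    refine ⟨-i, ?_⟩
    have hi' : ⁅π a, π b⁆ ^ i = π x := hi
    rw [← hπ1, map_mul, map_zpow, hcommel, ← hi', zpow_neg, inv_mul_cancel]
  have hpow' := pow_prime_eq_one hp hk hkp hsep hab' hdec hH hgen hpow
  have hcen' := commutator_le_center hp hk hkp hsep hab' hdec hH hgen
  obtain ⟨α, β, r, hrβ, hαβ, hαr, hαr1, hcl⟩ :=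
    exists_generators hp hk hkp hsep hab' hdec hH hgen hkc hpow
  exact ⟨(MulEquiv.ofBijective (semidirectHom hpow' hcen' hrβ.symm α)
    ⟨semidirectHom_injective hpow' hcen' hrβ.symm hp hαr1
      (fun h => hαβ (Subgroup.zpowers_le.2 hαr h)),
    semidirectHom_surjective hpow' hcen' hrβ.symm hcl⟩).symm⟩

/-- The chain gives `g * p ^ 3 ≤ p ^ T * i₁ * i₂ * i₃`, whose upper bound `p ^ (T + 2 * m + 2)` is
the exact value of `g * p ^ 3` by `hg`. So there is no slack. -/
theorem le_of_chain_le {p m T g q h A i₁ i₂ i₃ : ℕ} (hp : 0 < p) (h1 : g * p ≤ q * i₁)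
    (h2 : q * p ≤ h * i₂) (h3 : h * p ≤ A * i₃) (hA : A ≤ p ^ T) (hi₁ : i₁ ≤ p ^ m)
    (hi₂ : i₂ ≤ p ^ m) (hi₃ : i₃ ≤ p ^ 2) (hg : g * p ^ (m + 4) = p ^ (T + 3 * m + 3)) :
    p ^ m ≤ i₂ ∧ p ^ 2 ≤ i₃ := by
  have key : p ^ m * p ^ m * p ^ 2 ≤ i₁ * i₂ * i₃ := by
    refine _root_.le_of_mul_le_mul_left (a := p ^ (T + m + 1)) ?_ (pow_pos hp _)
    calc p ^ (T + m + 1) * (p ^ m * p ^ m * p ^ 2) = p ^ (T + 3 * m + 3) := by ring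
      _ = p ^ (m + 1) * ((g * p) * p * p) := by rw [← hg]; ring
      _ ≤ p ^ (m + 1) * ((q * i₁) * p * p) := by gcongr
      _ = p ^ (m + 1) * ((q * p) * p * i₁) := by ring
      _ ≤ p ^ (m + 1) * ((h * i₂) * p * i₁) := by gcongr
      _ = p ^ (m + 1) * ((h * p) * i₂ * i₁) := by ring
      _ ≤ p ^ (m + 1) * ((p ^ T * i₃) * i₂ * i₁) :=
        Nat.mul_le_mul_left _ (Nat.mul_le_mul_right _ (Nat.mul_le_mul_right _
          (h3.trans (Nat.mul_le_mul_right _ hA))))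
      _ = p ^ (T + m + 1) * (i₁ * i₂ * i₃) := by ring
  constructor
  · refine _root_.le_of_mul_le_mul_left (a := p ^ m * p ^ 2) ?_ (by positivity)
    calc p ^ m * p ^ 2 * p ^ m = p ^ m * p ^ m * p ^ 2 := by ring
      _ ≤ i₁ * i₂ * i₃ := key
      _ ≤ p ^ m * i₂ * p ^ 2 := by gcongr
      _ = _ := by ring
  · refine _root_.le_of_mul_le_mul_left (a := p ^ m * p ^ m) ?_ (by positivity)
    exact key.trans (by gcongr)

theorem quotient_mulEquiv (hp : p.Prime) {n : ℕ} {G : Type u} [Group G]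
    (hG : Nat.card G = p ^ n) (hcomm : Nat.card (commutator G) = p ^ 3)
    (ht : HasCorank p G (n + 1)) (K : Subgroup G) [K.Normal]
    (hK : K ≤ Subgroup.center G ⊓ commutator G) (hKp : Nat.card K = p) :
    p ≠ 2 ∧ Nonempty (G ⧸ K ≃* ZpFourSemidirectZp p) := by
  have : Finite G := Nat.finite_of_card_ne_zero (by rw [hG]; exact pow_ne_zero _ hp.ne_zero)
  have : Fact p.Prime := ⟨hp⟩
  obtain ⟨m, rfl⟩ : ∃ m, n = m + 3 := by
    have h1 : p ^ 3 ∣ p ^ n := by rw [← hcomm, ← hG]; exact Subgroup.card_subgroup_dvd_card _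
    exact ⟨n - 3, by have := (Nat.pow_dvd_pow_iff_le_right hp.one_lt).1 h1; omega⟩
  have hindex : (commutator G).index = p ^ m := by
    have h1 := Subgroup.card_mul_index (commutator G)
    rw [hcomm, hG, pow_add, mul_comm (p ^ m)] at h1
    exact Nat.mul_left_cancel (pow_pos hp.pos _) h1
  -- a generator of `K`
  obtain ⟨k₁, hk₁⟩ : ∃ k₁, K = Subgroup.zpowers k₁ := by
    have := isCyclic_of_prime_card hKp
    obtain ⟨⟨k₁, h1⟩, h2⟩ := IsCyclic.exists_generator (α := K)
    refine ⟨k₁, le_antisymm (fun x hx => ?_) (Subgroup.zpowers_le.2 h1)⟩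
    obtain ⟨i, hi⟩ := h2 ⟨x, hx⟩
    exact ⟨i, congrArg Subtype.val hi⟩
  have hk₁K : k₁ ∈ K := hk₁ ▸ Subgroup.mem_zpowers k₁
  have hk₁c := (hK hk₁K).1
  -- orders in `Q = G ⧸ K`
  have hQ : Nat.card (G ⧸ K) = p ^ (m + 2) := by
    have h1 := Subgroup.card_eq_card_quotient_mul_card_subgroup K
    rw [hG, hKp] at h1
    exact (Nat.mul_right_cancel hp.pos h1).symm
  have hQi : (commutator (G ⧸ K)).index = p ^ m := by
    rw [index_commutator_quotient K (hK.trans inf_le_right), hindex]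
  have hQc : Nat.card (commutator (G ⧸ K)) = p ^ 2 := by
    have h1 := Subgroup.card_mul_index (commutator (G ⧸ K))
    rw [hQi, hQ, pow_add, mul_comm (p ^ m)] at h1
    exact Nat.mul_right_cancel (pow_pos hp.pos _) h1
  obtain ⟨k, hkc, hk, hkp⟩ := exists_central_generator hp hQ (by
    rw [hQc]; exact (Nat.one_lt_pow two_ne_zero hp.one_lt).ne')
  have hkn : (Subgroup.zpowers k).Normal := normal_of_le_center (Subgroup.zpowers_le.2 hk)
  -- orders in `H = Q ⧸ ⟨k⟩`
  have hH : Nat.card ((G ⧸ K) ⧸ Subgroup.zpowers k) = p ^ (m + 1) := by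
    have h1 := Subgroup.card_eq_card_quotient_mul_card_subgroup (Subgroup.zpowers k)
    rw [hQ, Nat.card_zpowers, hkp] at h1
    exact (Nat.mul_right_cancel hp.pos h1).symm
  have hHi : (commutator ((G ⧸ K) ⧸ Subgroup.zpowers k)).index = p ^ m := by
    rw [index_commutator_quotient _ (Subgroup.zpowers_le.2 hkc), hQi]
  have hHc : Nat.card (commutator ((G ⧸ K) ⧸ Subgroup.zpowers k)) = p := by
    have h1 := Subgroup.card_mul_index (commutator ((G ⧸ K) ⧸ Subgroup.zpowers k))
    rw [hHi, hH, pow_succ, mul_comm (p ^ m)] at h1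
    exact Nat.mul_right_cancel (pow_pos hp.pos _) h1
  obtain ⟨z, hzc, hz, hzp⟩ := exists_central_generator hp hH (by
    rw [hHc]; exact hp.one_lt.ne')
  have hzH : commutator ((G ⧸ K) ⧸ Subgroup.zpowers k) = Subgroup.zpowers z :=
    (Subgroup.eq_of_le_of_card_ge (Subgroup.zpowers_le.2 hzc) (by
      rw [hHc, Nat.card_zpowers, hzp])).symm
  obtain ⟨a, b, hab⟩ : ∃ a b : (G ⧸ K) ⧸ Subgroup.zpowers k, ¬ Commute a b := by
    by_contra! h
    have h1 : commutator ((G ⧸ K) ⧸ Subgroup.zpowers k) ≤ ⊥ := Subgroup.commutator_le.2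
      fun x _ y _ => commutatorElement_eq_one_iff_commute.2 (h x y)
    rw [le_bot_iff.1 h1, Subgroup.card_bot] at hHc
    exact hp.one_lt.ne hHc
  -- multipliers
  obtain ⟨hfA, hA⟩ := card_cocycleClass_le_of_card_eq hp m
    (((G ⧸ K) ⧸ Subgroup.zpowers k) ⧸ commutator ((G ⧸ K) ⧸ Subgroup.zpowers k)) hHi
  have hfH := (card_cocycleClass_le_of_card_eq hp _ _ hH).1
  have hfQ := (card_cocycleClass_le_of_card_eq hp _ _ hQ).1
  have h1 := card_cocycleClass_mul_le hk₁c K hk₁ (hK hk₁K).2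
  have h2 := card_cocycleClass_mul_le hk _ rfl hkc
  have h3 := card_cocycleClass_mul_le hz _ hzH hzc
  rw [hKp] at h1
  rw [Nat.card_zpowers, hkp] at h2
  rw [hHc] at h3
  have hi₁ := card_range_classPairing_le_index hk₁c
  have hi₂ := card_range_classPairing_le_index hk
  rw [hindex] at hi₁
  rw [hQi] at hi₂
  have hg : Nat.card (CocycleClass G) * p ^ (m + 4) = p ^ (m * (m - 1) / 2 + 3 * m + 3) := by
    obtain ⟨n', hn', ht⟩ := ht
    rw [hG] at hn'
    obtain rfl := Nat.pow_right_injective hp.two_le hn'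
    rw [card_schurMultiplier] at ht
    refine ht.trans (congrArg _ ?_)
    -- For `n = m + 3` the exponent `n * (n - 1) / 2` is `m * (m - 1) / 2 + m + (m + 1) + (m + 2)`.
    rw [Nat.triangle_succ (m + 2), Nat.triangle_succ (m + 1), Nat.triangle_succ m]
    omega
  obtain ⟨h4, h5⟩ := le_of_chain_le hp.pos h1 h2 h3 hA hi₁ hi₂
    (card_range_classPairing_le hp hz hzp hzH hab) hg
  exact nonempty_mulEquiv_of_card_range hp hk hkc hkp (hQi ▸ h4) hz hzp hzH h5

end Assembly

theorem mainTheorem7 (p : ℕ) (hp : p.Prime) (n : ℕ) (G : Type u) [Group G]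
    (hG : Nat.card G = p ^ n)
    (hnonab : ¬ ∀ x y : G, x * y = y * x)
    (hcomm : Nat.card (commutator G) = p ^ 3)
    (ht : HasCorank p G (n + 1)) :
    p ≠ 2 ∧
    (∀ K : Subgroup G, K ≤ Subgroup.center G ⊓ commutator G → Nat.card K = p →
      ∃ _ : K.Normal, Nonempty (G ⧸ K ≃* ZpFourSemidirectZp p)) ∧
    Nat.card G = p ^ 6 := by
  have hfin : Finite G := Nat.finite_of_card_ne_zero (by rw [hG]; exact pow_ne_zero _ hp.ne_zero)
  obtain ⟨k, hkc, hk, hkp⟩ := exists_central_generator hp hG (by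
    rw [hcomm]; exact (Nat.one_lt_pow three_ne_zero hp.one_lt).ne')
  have hkn : (Subgroup.zpowers k).Normal := normal_of_le_center (Subgroup.zpowers_le.2 hk)
  obtain ⟨h2, ⟨e⟩⟩ := quotient_mulEquiv hp hG hcomm ht (Subgroup.zpowers k)
    (Subgroup.zpowers_le.2 ⟨hk, hkc⟩) ((Nat.card_zpowers k).trans hkp)
  refine ⟨h2, fun K hK hKp => ?_, ?_⟩
  · have hKn : K.Normal := normal_of_le_center (hK.trans inf_le_left)
    exact ⟨hKn, (quotient_mulEquiv hp hG hcomm ht K hK hKp).2⟩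
  · rw [Subgroup.card_eq_card_quotient_mul_card_subgroup (Subgroup.zpowers k),
      Nat.card_congr e.toEquiv, card_zpFourSemidirectZp, Nat.card_zpowers, hkp, ← pow_succ]
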